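/- There are absolute constants $c>0$ (real) and $n\ge 1$ (integer) such that the following holds. Let $q\ge 4$ be a prime power, let $H=\mathrm{SL}(2,q)$ be the group of $2\times 2$ matrices of determinant $1$ over the field with $q$ elements, let $3\le k\le t$ be integers, and put $m=\lceil(1+c)k\rceil$. Call a probability distribution $p$ on a finite set $S$ $\varepsilon$-uniform if $|p(x)-1/|S||\le\varepsilon/|S|$ for every $x\in S$. For $j\le t$, call a probability distribution on $H^t$ $(\varepsilon,j)$-uniform if for every choice of $j$ of the $t$ coordinates the distribution it induces on these coordinates is $\varepsilon$-uniform on $H^j$. The convolution of distributions on the group $H^t$ is $(p*q)(x)=\sum_y p(y)q(y^{-1}x)$. Let $p$ be a $(|H|^{-k},k)$-uniform probability distribution on $H^t$, and let $p^{*n}$ be the convolution of $n$ independent copies of $p$. If $t\ge m$, then $p^{*n}$ is $(|H|^{-m},m)$-uniform. If $t\le m$, then $p^{*n}$ is $|H|^{-m}$-uniform on the whole of $H^t$. (Both apply, and agree, when $t=m$.) -/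

import Mathlib

/-- A real function `p` on a finite set `S` (in particular a probability distribution on `S`)
is `ε`-uniform if `|p x - 1/|S|| ≤ ε/|S|` for every `x`. -/
def IsEpsUniform {S : Type*} [Fintype S] (ε : ℝ) (p : S → ℝ) : Prop :=
  ∀ x, |p x - 1 / (Fintype.card S : ℝ)| ≤ ε / (Fintype.card S : ℝ)

open Classical in
/-- The distribution induced by `p` on the coordinates in `I`. -/
noncomputable def coordMarginal {t : ℕ} {H : Type*} [Fintype H]
    (p : (Fin t → H) → ℝ) (I : Finset (Fin t)) : (I → H) → ℝ :=
  fun y => ∑ x : Fin t → H with (∀ i : I, x i = y i), p x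

/-- `p` on `H ^ t` is `(ε, k)`-uniform if, for any `k` coordinates, the distribution induced
on those coordinates is `ε`-uniform (used for `k ≤ t`). -/
def IsEpsKUniform {t : ℕ} {H : Type*} [Fintype H] (ε : ℝ) (k : ℕ)
    (p : (Fin t → H) → ℝ) : Prop :=
  ∀ I : Finset (Fin t), I.card = k → IsEpsUniform ε (coordMarginal p I)

/-- Convolution on a finite group, `(p * q)(x) = ∑ y, p(y) q(y⁻¹ x)`. -/
def groupConv {G : Type*} [Group G] [Fintype G] (p q : G → ℝ) : G → ℝ :=
  fun x => ∑ y, p y * q (y⁻¹ * x)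

open Classical in
/-- The convolution of `n` independent copies of `p`, i.e. the distribution of a product of `n`
independent samples from `p` (for `n = 0` the point mass at the identity). -/
noncomputable def groupConvPow {G : Type*} [Group G] [Fintype G] (p : G → ℝ) : ℕ → G → ℝ
  | 0 => fun x => if x = 1 then 1 else 0
  | n + 1 => groupConv p (groupConvPow p n)

/-! Let G = H^t, h = |H|, u the uniform distribution, and T convolution by p - u on functions on G.
Since T^n applied to the point mass at 1 is p^{*n} - u for n ≥ 1, it suffices to bound the
eigenvalues μ of T*T by a fixed power of h^{-k}.

T commutes with right translations, so an eigenspace of T*T is a representation of G. It contains a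
vector g that, in each coordinate, is either fixed by H or is an eigenvector of the upper unipotents
with a nontrivial character (`exists_coordwise_fixed_or_eigenvector`). Let S be the set of
coordinates of the second kind.

If |S| ≤ k, then g depends on at most k coordinates and the hypothesis on the marginals gives μ ≤
h^{-2k} (`norm_convOp_le_of_fixed`). If |S| > k, the torus changes the characters, so the eigenspace
has dimension at least d^{k+1}, where d is the number of nonzero squares. Comparison with the
Hilbert-Schmidt norm of T gives μ d^{k+1} ≤ 2 h^{t-k} (`eigenvalue_mul_card_squares_pow_le`). This
quasirandomness bound suffices when q or k is large, as d is about q/2 or q, h ≤ q^3, and t - k is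
at most about k/144 + 1.

Only finitely many (q, k, t) remain. For them any positive spectral gap is enough, and
`norm_convOp_le_gapConst` supplies one: the support of p realises all patterns on pairs of
coordinates, and commutators generate G from such elements in a bounded number of steps.

For t ≥ m, the result on a set of m coordinates is the case t = m for the marginal of p. -/

/-! ### Translations and convolution operators -/

/-- Left translation on functions on a finite group, `(g · f)(x) = f (g⁻¹ x)`. -/
noncomputable def leftTranslation {G : Type*} [Group G] [Fintype G] (g : G) :
    EuclideanSpace ℂ G ≃ₗᵢ[ℂ] EuclideanSpace ℂ G :=
  LinearIsometryEquiv.piLpCongrLeft 2 ℂ ℂ (Equiv.mulLeft g)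

/-- Right translation on functions on a finite group, `(g · f)(x) = f (x g)`. -/
noncomputable def rightTranslation {G : Type*} [Group G] [Fintype G] (g : G) :
    EuclideanSpace ℂ G ≃ₗᵢ[ℂ] EuclideanSpace ℂ G :=
  LinearIsometryEquiv.piLpCongrLeft 2 ℂ ℂ (Equiv.mulRight g⁻¹)

/-- The operator of convolution by a real function on the left. -/
noncomputable def convOp {G : Type*} [Group G] [Fintype G] (a : G → ℝ) :
    EuclideanSpace ℂ G →ₗ[ℂ] EuclideanSpace ℂ G :=
  ∑ y, (a y : ℂ) • (leftTranslation y).toLinearMap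

section translations
variable {G : Type*} [Group G] [Fintype G]

@[simp] lemma leftTranslation_apply (g : G) (f : EuclideanSpace ℂ G) (x : G) :
    leftTranslation g f x = f (g⁻¹ * x) := by
  simp [leftTranslation, LinearIsometryEquiv.piLpCongrLeft_apply, Equiv.piCongrLeft']

@[simp] lemma rightTranslation_apply (g : G) (f : EuclideanSpace ℂ G) (x : G) :
    rightTranslation g f x = f (x * g) := by
  simp [rightTranslation, LinearIsometryEquiv.piLpCongrLeft_apply, Equiv.piCongrLeft']

lemma leftTranslation_mul (g h : G) (f : EuclideanSpace ℂ G) :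
    leftTranslation (g * h) f = leftTranslation g (leftTranslation h f) := by
  ext x; simp [mul_assoc]

lemma rightTranslation_mul (g h : G) (f : EuclideanSpace ℂ G) :
    rightTranslation (g * h) f = rightTranslation g (rightTranslation h f) := by
  ext x; simp [mul_assoc]

@[simp] lemma leftTranslation_one (f : EuclideanSpace ℂ G) : leftTranslation 1 f = f := by
  ext x; simp

@[simp] lemma rightTranslation_one (f : EuclideanSpace ℂ G) : rightTranslation 1 f = f := by
  ext x; simp

/-- The right regular representation. -/
noncomputable def rightRegular (G : Type*) [Group G] [Fintype G] :
    Representation ℂ G (EuclideanSpace ℂ G) where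
  toFun g := (rightTranslation g).toLinearMap
  map_one' := by ext1 f; exact rightTranslation_one f
  map_mul' g h := by ext1 f; exact rightTranslation_mul g h f

@[simp] lemma rightRegular_apply (g : G) (f : EuclideanSpace ℂ G) :
    rightRegular G g f = rightTranslation g f := rfl

lemma convOp_eq_sum (a : G → ℝ) (f : EuclideanSpace ℂ G) :
    convOp a f = ∑ y, (a y : ℂ) • leftTranslation y f := by
  simp [convOp]

lemma convOp_apply (a : G → ℝ) (f : EuclideanSpace ℂ G) (x : G) :
    convOp a f x = ∑ y, (a y : ℂ) * f (y⁻¹ * x) := by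
  simp [convOp_eq_sum]

/-- Left and right translations commute. Hence every eigenspace of T*T is invariant under right
translation. -/
lemma convOp_rightTranslation (a : G → ℝ) (g : G) (f : EuclideanSpace ℂ G) :
    convOp a (rightTranslation g f) = rightTranslation g (convOp a f) := by
  ext x; simp [convOp_apply, mul_assoc]

lemma adjoint_convOp (a : G → ℝ) :
    LinearMap.adjoint (convOp a) = convOp (fun y => a y⁻¹) := by
  symm
  rw [LinearMap.eq_adjoint_iff]
  intro f g
  have key : ∀ y : G, inner ℂ (leftTranslation y⁻¹ f) g = inner ℂ f (leftTranslation y g) := by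
    intro y
    rw [← (leftTranslation y).inner_map_map, ← leftTranslation_mul]
    simp
  rw [convOp_eq_sum, convOp_eq_sum, sum_inner, inner_sum,
    ← Equiv.sum_comp (Equiv.inv G)]
  refine Finset.sum_congr rfl fun y _ => ?_
  simp only [Equiv.inv_apply, inv_inv, inner_smul_left, inner_smul_right, Complex.conj_ofReal]
  rw [key]

lemma convOp_sub (a b : G → ℝ) (f : EuclideanSpace ℂ G) :
    convOp (fun x => a x - b x) f = convOp a f - convOp b f := by
  simp [convOp_eq_sum, sub_smul]

lemma convOp_const_eq_zero (c : ℝ) (f : EuclideanSpace ℂ G) (hf : ∑ x, f x = 0) :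
    convOp (fun _ => c) f = 0 := by
  ext x
  have : ∑ y : G, f (y⁻¹ * x) = ∑ y, f y :=
    Equiv.sum_comp ((Equiv.inv G).trans (Equiv.mulRight x)) f
  simp [convOp_apply, ← Finset.mul_sum, this, hf]

end translations

/-! ### Eigenvalues of T*T and the Hilbert-Schmidt bound -/

/-- A bound for the eigenvalues of `T* T` bounds `T`. -/
lemma norm_sq_apply_le_of_eigenvalues {V : Type*} [NormedAddCommGroup V] [InnerProductSpace ℂ V]
    [FiniteDimensional ℂ V] (T : V →ₗ[ℂ] V) (B : ℝ)
    (hB : ∀ (μ : ℝ) (f : V), f ≠ 0 → LinearMap.adjoint T (T f) = (μ : ℂ) • f → μ ≤ B) (f : V) :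
    ‖T f‖ ^ 2 ≤ B * ‖f‖ ^ 2 := by
  have hs : (LinearMap.adjoint T * T).IsSymmetric := LinearMap.isSymmetric_adjoint_mul_self T
  let b := hs.eigenvectorBasis rfl
  have hb : ∀ i, LinearMap.adjoint T (T (b i)) = (hs.eigenvalues rfl i : ℂ) • b i :=
    fun i => hs.apply_eigenvectorBasis rfl i
  have h1 : ((‖T f‖ ^ 2 : ℝ) : ℂ) = ∑ i, inner ℂ f (b i) * inner ℂ (b i) (LinearMap.adjoint T (T f)) := by
    rw [b.sum_inner_mul_inner, LinearMap.adjoint_inner_right, inner_self_eq_norm_sq_to_K]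
    simp
  have h2 : ∀ i, inner ℂ f (b i) * inner ℂ (b i) (LinearMap.adjoint T (T f)) =
      ((hs.eigenvalues rfl i * ‖(inner ℂ (b i) f : ℂ)‖ ^ 2 : ℝ) : ℂ) := by
    intro i
    have : (inner ℂ (b i) (LinearMap.adjoint T (T f)) : ℂ) = hs.eigenvalues rfl i * inner ℂ (b i) f := by
      rw [LinearMap.adjoint_inner_right, ← LinearMap.adjoint_inner_left, hb, inner_smul_left]
      simp
    rw [this, ← inner_conj_symm f (b i)]
    push_cast
    rw [← Complex.conj_mul']
    ring
  simp only [h2] at h1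
  rw [← Complex.ofReal_sum] at h1
  have h3 := Complex.ofReal_injective h1
  rw [h3, ← b.sum_sq_norm_inner_right f, Finset.mul_sum]
  refine Finset.sum_le_sum fun i _ => ?_
  refine mul_le_mul_of_nonneg_right (hB _ (b i) ?_ (hb i)) (by positivity)
  exact b.orthonormal.ne_zero i

lemma norm_sq_of_adjoint_apply {V : Type*} [NormedAddCommGroup V] [InnerProductSpace ℂ V]
    [FiniteDimensional ℂ V] (T : V →ₗ[ℂ] V) (μ : ℝ) (f : V)
    (h : LinearMap.adjoint T (T f) = (μ : ℂ) • f) : ‖T f‖ ^ 2 = μ * ‖f‖ ^ 2 := by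
  have h1 : inner ℂ (T f) (T f) = (μ : ℂ) * inner ℂ f f := by
    rw [← LinearMap.adjoint_inner_right, h, inner_smul_right]
  rw [inner_self_eq_norm_sq_to_K, inner_self_eq_norm_sq_to_K] at h1
  apply Complex.ofReal_injective
  simpa using h1

/-- A family of orthogonal eigenvectors of `T* T` of equal norms, where `T` is convolution by `a`. -/
lemma eigenvalue_mul_card_le {G : Type*} [Group G] [Fintype G] (a : G → ℝ) (μ : ℝ)
    {κ : Type*} [Fintype κ] (v : κ → EuclideanSpace ℂ G) (hv0 : ∀ i, v i ≠ 0)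
    (hv : ∀ i, LinearMap.adjoint (convOp a) (convOp a (v i)) = (μ : ℂ) • v i)
    (ho : ∀ i j, i ≠ j → inner ℂ (v i) (v j) = 0) :
    μ * Fintype.card κ ≤ Fintype.card G * ∑ x, a x ^ 2 := by
  classical
  let w : κ → EuclideanSpace ℂ G := fun i => ((‖v i‖⁻¹ : ℝ) : ℂ) • v i
  have hn : ∀ i, ‖w i‖ = 1 := by
    intro i
    simp only [w, norm_smul, Complex.norm_real, norm_inv, norm_norm]
    exact inv_mul_cancel₀ (norm_ne_zero_iff.2 (hv0 i))
  have hw : Orthonormal ℂ w := by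
    refine ⟨hn, fun i j hij => ?_⟩
    simp [w, inner_smul_left, inner_smul_right, ho i j hij]
  have hwe : ∀ i, ‖convOp a (w i)‖ ^ 2 = μ := by
    intro i
    rw [norm_sq_of_adjoint_apply _ μ, hn]
    · simp
    · simp only [w, map_smul, hv]
      rw [smul_comm]
  -- The value of T w_i at x is, up to conjugation, the inner product of w_i with T*δ_x. Bessel's
  -- inequality then applies for each x separately.
  have hT : ∀ x i, ‖convOp a (w i) x‖ ^ 2 =
      ‖(inner ℂ (w i) (LinearMap.adjoint (convOp a) (EuclideanSpace.single x (1 : ℂ))) : ℂ)‖ ^ 2 := by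
    intro x i
    rw [LinearMap.adjoint_inner_right, EuclideanSpace.inner_single_right]
    simp
  have hx : ∀ x : G, ‖LinearMap.adjoint (convOp a) (EuclideanSpace.single x (1 : ℂ))‖ ^ 2 =
      ∑ y, a y ^ 2 := by
    intro x
    rw [EuclideanSpace.norm_sq_eq, adjoint_convOp]
    have : ∀ y, convOp (fun y => a y⁻¹) (EuclideanSpace.single x (1 : ℂ)) y = a (x * y⁻¹) := by
      intro y
      rw [convOp_apply, Finset.sum_eq_single (y * x⁻¹)]
      · simp
      · intro z _ hz
        have : z⁻¹ * y ≠ x := by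
          rintro rfl
          exact hz (by group)
        simp [this]
      · simp
    simp only [this, Complex.norm_real, Real.norm_eq_abs, sq_abs]
    exact Equiv.sum_comp ((Equiv.inv G).trans (Equiv.mulLeft x)) (fun y => a y ^ 2)
  calc μ * Fintype.card κ = ∑ i, ‖convOp a (w i)‖ ^ 2 := by
        simp [hwe, mul_comm]
    _ = ∑ x, ∑ i, ‖(inner ℂ (w i)
          (LinearMap.adjoint (convOp a) (EuclideanSpace.single x (1 : ℂ))) : ℂ)‖ ^ 2 := by
        rw [Finset.sum_comm]
        refine Finset.sum_congr rfl fun i _ => ?_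
        rw [EuclideanSpace.norm_sq_eq]
        exact Finset.sum_congr rfl fun x _ => hT x i
    _ ≤ ∑ x : G, ‖LinearMap.adjoint (convOp a) (EuclideanSpace.single x (1 : ℂ))‖ ^ 2 :=
        Finset.sum_le_sum fun x _ => hw.sum_inner_products_le _
    _ = _ := by simp [hx]

/-! ### Powers of the convolution operator -/

section power
variable {G : Type*} [Group G] [Fintype G]

lemma sum_groupConv (p q : G → ℝ) : ∑ x, groupConv p q x = (∑ x, p x) * ∑ x, q x := by
  unfold groupConv
  rw [Finset.sum_comm, Finset.sum_mul]
  refine Finset.sum_congr rfl fun y _ => ?_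
  rw [← Finset.mul_sum]
  congr 1
  exact Equiv.sum_comp (Equiv.mulLeft y⁻¹) q

lemma sum_groupConvPow (p : G → ℝ) (hp : ∑ x, p x = 1) (n : ℕ) :
    ∑ x, groupConvPow p n x = 1 := by
  induction n with
  | zero => classical simp [groupConvPow, Finset.sum_ite_eq']
  | succ n ih => rw [groupConvPow, sum_groupConv, hp, ih, one_mul]

/-- For a probability distribution `p`, powers of convolution by `p - u`, `u` uniform. -/
lemma convOp_pow_single (p : G → ℝ) (hp : ∑ x, p x = 1) (n : ℕ) [DecidableEq G] (x : G) :
    ((convOp fun x => p x - 1 / (Fintype.card G : ℝ)) ^ (n + 1))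
      (EuclideanSpace.single 1 (1 : ℂ)) x =
      ((groupConvPow p (n + 1) x - 1 / (Fintype.card G : ℝ) : ℝ) : ℂ) := by
  have hN : (Fintype.card G : ℝ) ≠ 0 := by exact_mod_cast Fintype.card_ne_zero
  induction n generalizing x with
  | zero =>
    rw [zero_add, pow_one, convOp_apply, Finset.sum_eq_single x]
    · simp only [groupConvPow, groupConv]
      rw [Finset.sum_eq_single x]
      · simp
      · intro y _ hy
        have : y⁻¹ * x ≠ 1 := by
          intro h; exact hy (inv_mul_eq_one.1 h)
        simp [this]
      · simp
    · intro y _ hy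
      have : y⁻¹ * x ≠ 1 := by
        intro h; exact hy (inv_mul_eq_one.1 h)
      simp [this]
    · simp
  | succ n ih =>
    rw [pow_succ', Module.End.mul_apply, convOp_apply]
    simp only [ih]
    simp only [← Complex.ofReal_mul, ← Complex.ofReal_sum]
    congr 1
    -- Both factors have total mass one, so (p - u) * (r - u) = p * r - u.
    have h1 := sum_groupConvPow p hp (n + 1)
    have h2 : ∑ y : G, groupConvPow p (n + 1) (y⁻¹ * x) = 1 := by
      rw [← h1]
      exact Equiv.sum_comp ((Equiv.inv G).trans (Equiv.mulRight x)) (groupConvPow p (n + 1))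
    rw [show groupConvPow p (n + 1 + 1) x = ∑ y, p y * groupConvPow p (n + 1) (y⁻¹ * x) from rfl]
    simp only [sub_mul, mul_sub, Finset.sum_sub_distrib, ← Finset.sum_mul, ← Finset.mul_sum, hp, h2]
    simp

lemma norm_pow_apply_le {V : Type*} [NormedAddCommGroup V] [NormedSpace ℂ V] (T : V →ₗ[ℂ] V)
    (B : ℝ) (hB0 : 0 ≤ B) (hB : ∀ f, ‖T f‖ ^ 2 ≤ B * ‖f‖ ^ 2) (n : ℕ) (f : V) :
    ‖(T ^ n) f‖ ^ 2 ≤ B ^ n * ‖f‖ ^ 2 := by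
  induction n with
  | zero => simp
  | succ n ih =>
    rw [pow_succ' T, Module.End.mul_apply, pow_succ' B, mul_assoc]
    exact (hB _).trans (mul_le_mul_of_nonneg_left ih hB0)

/-- The point mass at 1 is a unit vector, and a value of a function is at most its Euclidean norm.
-/
lemma groupConvPow_sub_sq_le (p : G → ℝ) (hp : ∑ x, p x = 1) (B : ℝ) (hB0 : 0 ≤ B)
    (hB : ∀ f, ‖convOp (fun x => p x - 1 / (Fintype.card G : ℝ)) f‖ ^ 2 ≤ B * ‖f‖ ^ 2) (n : ℕ)
    (x : G) :
    (groupConvPow p (n + 1) x - 1 / (Fintype.card G : ℝ)) ^ 2 ≤ B ^ (n + 1) := by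
  classical
  have h := norm_pow_apply_le _ B hB0 hB (n + 1) (EuclideanSpace.single 1 (1 : ℂ))
  have h1 := PiLp.norm_apply_le (((convOp fun x => p x - 1 / (Fintype.card G : ℝ)) ^ (n + 1))
      (EuclideanSpace.single 1 (1 : ℂ))) x
  rw [convOp_pow_single p hp, Complex.norm_real, Real.norm_eq_abs] at h1
  have h2 := pow_le_pow_left₀ (abs_nonneg _) h1 2
  rw [sq_abs] at h2
  refine h2.trans (h.trans ?_)
  simp

end power

/-! ### Unipotents, torus and representations of SL(2, F) -/

namespace Matrix.SpecialLinearGroup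

variable {F : Type*} [Field F]

/-- The upper unipotent element with upper right entry `u`. -/
def upper (u : F) : Matrix.SpecialLinearGroup (Fin 2) F :=
  ⟨!![1, u; 0, 1], by simp [Matrix.det_fin_two]⟩

/-- The lower unipotent element with lower left entry `u`. -/
def lower (u : F) : Matrix.SpecialLinearGroup (Fin 2) F :=
  ⟨!![1, 0; u, 1], by simp [Matrix.det_fin_two]⟩

/-- The Weyl element. -/
def weyl (F : Type*) [Field F] : Matrix.SpecialLinearGroup (Fin 2) F :=
  ⟨!![0, 1; -1, 0], by simp [Matrix.det_fin_two]⟩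

/-- The diagonal element with entries `a`, `a⁻¹`. -/
def torus (a : Fˣ) : Matrix.SpecialLinearGroup (Fin 2) F :=
  ⟨!![(a : F), 0; 0, ((a⁻¹ : Fˣ) : F)], by simp [Matrix.det_fin_two]⟩

@[simp] lemma coe_upper (u : F) : (upper u : Matrix (Fin 2) (Fin 2) F) = !![1, u; 0, 1] := rfl

@[simp] lemma coe_lower (u : F) : (lower u : Matrix (Fin 2) (Fin 2) F) = !![1, 0; u, 1] := rfl

@[simp] lemma coe_weyl : (weyl F : Matrix (Fin 2) (Fin 2) F) = !![0, 1; -1, 0] := rfl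

@[simp] lemma coe_torus (a : Fˣ) :
    (torus a : Matrix (Fin 2) (Fin 2) F) = !![(a : F), 0; 0, ((a⁻¹ : Fˣ) : F)] := rfl

lemma upper_mul (u v : F) : upper u * upper v = upper (u + v) := by
  ext i j; fin_cases i <;> fin_cases j <;> simp [Matrix.mul_apply, Fin.sum_univ_two, add_comm]

@[simp] lemma upper_zero : upper (0 : F) = 1 := by
  ext i j; fin_cases i <;> fin_cases j <;> simp

lemma weyl_conj_upper (u : F) : weyl F * upper u = lower (-u) * weyl F := by
  ext i j; fin_cases i <;> fin_cases j <;>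
    simp [Matrix.mul_apply, Fin.sum_univ_two]

lemma upper_mul_torus (u : F) (a : Fˣ) :
    upper u * torus a = torus a * upper (((a ^ 2)⁻¹ : Fˣ) * u) := by
  ext i j; fin_cases i <;> fin_cases j <;>
    simp [Matrix.mul_apply, Fin.sum_univ_two]
  field_simp

lemma torus_mul_upper (u : F) (a : Fˣ) :
    torus a * upper u = upper ((a : F) ^ 2 * u) * torus a := by
  ext i j; fin_cases i <;> fin_cases j <;>
    simp [Matrix.mul_apply, Fin.sum_univ_two]
  field_simp

/-- Every element is a product of four unipotents. -/
lemma exists_eq_upper_lower (g : Matrix.SpecialLinearGroup (Fin 2) F) :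
    ∃ a b c d : F, g = upper a * lower b * upper c * lower d := by
  have key : ∀ g : Matrix.SpecialLinearGroup (Fin 2) F, g.1 1 0 ≠ 0 →
      ∃ a b c : F, g = upper a * lower b * upper c := by
    intro g hg
    have hdet := g.2
    rw [Matrix.det_fin_two] at hdet
    refine ⟨(g.1 0 0 - 1) / g.1 1 0, g.1 1 0, (g.1 1 1 - 1) / g.1 1 0, ?_⟩
    ext i j; fin_cases i <;> fin_cases j <;>
      simp [Matrix.mul_apply, Fin.sum_univ_two] <;> field_simp
    all_goals first | ring1 | linear_combination -hdet
  by_cases hg : g.1 1 0 = 0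
  · have hdet := g.2
    rw [Matrix.det_fin_two, hg] at hdet
    have h11 : g.1 1 1 ≠ 0 := by
      rintro h; rw [h] at hdet; simp at hdet
    -- When the lower left entry vanishes, multiplying by `lower 1` moves the nonzero lower right
    -- entry into its place.
    obtain ⟨a, b, c, h⟩ := key (g * lower 1) (by
      simpa [Matrix.mul_apply, Fin.sum_univ_two, hg] using h11)
    refine ⟨a, b, c, -1, ?_⟩
    rw [← h, mul_assoc]
    have : lower (1 : F) * lower (-1) = 1 := by
      ext i j; fin_cases i <;> fin_cases j <;> simp [Matrix.mul_apply, Fin.sum_univ_two]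
    rw [this, mul_one]
  · obtain ⟨a, b, c, h⟩ := key g hg
    refine ⟨a, b, c, 0, ?_⟩
    have : lower (0 : F) = 1 := by
      ext i j; fin_cases i <;> fin_cases j <;> simp
    rw [← h, this, mul_one]

/-- The order of `SL(2, q)` is at most `q ^ 3`. -/
lemma card_fin_two_le [Fintype F] [DecidableEq F] :
    Fintype.card (Matrix.SpecialLinearGroup (Fin 2) F) ≤ Fintype.card F ^ 3 := by
  have : Fintype.card (F × F × F) = Fintype.card F ^ 3 := by
    simp [Fintype.card_prod]; ring
  rw [← this]
  refine Fintype.card_le_of_injective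
    (fun g => (g.1 0 0, g.1 0 1, if g.1 0 0 = 0 then g.1 1 1 else g.1 1 0)) ?_
  intro g g' h
  simp only [Prod.mk.injEq] at h
  obtain ⟨h00, h01, h3⟩ := h
  have d1 := g.2
  have d2 := g'.2
  rw [Matrix.det_fin_two] at d1 d2
  rw [← h00] at h3 d2
  rw [← h01] at d2
  have : g.1 1 0 = g'.1 1 0 ∧ g.1 1 1 = g'.1 1 1 := by
    by_cases h0 : g.1 0 0 = 0
    · rw [if_pos h0, if_pos h0] at h3
      refine ⟨?_, h3⟩
      rw [h0] at d1 d2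
      have hb : g.1 0 1 ≠ 0 := by
        intro h; rw [h] at d1; simp at d1
      apply mul_left_cancel₀ hb
      linear_combination d2 - d1
    · rw [if_neg h0, if_neg h0] at h3
      refine ⟨h3, ?_⟩
      apply mul_left_cancel₀ h0
      rw [h3] at d1
      linear_combination d1 - d2
  ext i j
  fin_cases i <;> fin_cases j
  exacts [h00, h01, this.1, this.2]

/-- The order of `SL(2, q)` is at least `q`. -/
lemma le_card_fin_two [Fintype F] [DecidableEq F] :
    Fintype.card F ≤ Fintype.card (Matrix.SpecialLinearGroup (Fin 2) F) := by
  refine Fintype.card_le_of_injective upper fun u v h => ?_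
  have := congrArg (fun g : Matrix.SpecialLinearGroup (Fin 2) F => g.1 0 1) h
  simpa using this

/-- A vector fixed by all conjugates of the upper unipotents is fixed by `SL(2, F)`. -/
lemma fixed_of_upper_fixed {V : Type*} [AddCommGroup V] [Module ℂ V]
    (ρ : Representation ℂ (Matrix.SpecialLinearGroup (Fin 2) F) V) (f : V)
    (hf : ∀ h u, ρ (upper u) (ρ h f) = ρ h f) (g : Matrix.SpecialLinearGroup (Fin 2) F) :
    ρ g f = f := by
  have hU : ∀ u, ρ (upper u) f = f := fun u => by simpa using hf 1 u
  have hL : ∀ u, ρ (lower u) f = f := by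
    intro u
    have h1 : lower u = weyl F * upper (-u) * (weyl F)⁻¹ := by
      rw [weyl_conj_upper, neg_neg, mul_inv_cancel_right]
    rw [h1, map_mul, map_mul, Module.End.mul_apply, Module.End.mul_apply, hf,
      ← Module.End.mul_apply, ← map_mul, mul_inv_cancel, map_one, Module.End.one_apply]
  obtain ⟨a, b, c, d, rfl⟩ := exists_eq_upper_lower g
  simp only [map_mul, Module.End.mul_apply, hU, hL]

/-- In a nonzero invariant subspace there is a nonzero vector that is fixed by the group or is an
eigenvector of the upper unipotents with a nontrivial character. -/
lemma exists_fixed_or_eigenvector [Fintype F] {V : Type*} [AddCommGroup V] [Module ℂ V]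
    (ρ : Representation ℂ (Matrix.SpecialLinearGroup (Fin 2) F) V) (E : Submodule ℂ V)
    (hE : ∀ g, ∀ f ∈ E, ρ g f ∈ E) (f : V) (hf : f ∈ E) (hf0 : f ≠ 0) :
    ∃ f' ∈ E, f' ≠ 0 ∧ ((∀ g, ρ g f' = f') ∨
      ∃ ψ : AddChar F ℂ, ψ ≠ 1 ∧ ∀ u, ρ (upper u) f' = ψ u • f') := by
  classical
  by_cases hfix : ∀ h u, ρ (upper u) (ρ h f) = ρ h f
  · exact ⟨f, hf, hf0, Or.inl (fixed_of_upper_fixed ρ f hfix)⟩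
  push Not at hfix
  obtain ⟨h, u₀, hne⟩ := hfix
  set g := ρ h f with hg
  have hgE : g ∈ E := hE h f hf
  -- The unnormalised projection to the ψ-eigenspace of the upper unipotents; by Fourier inversion
  -- these components add up to |F| g.
  let e : AddChar F ℂ → V := fun ψ => ∑ u, ψ (-u) • ρ (upper u) g
  have heig : ∀ ψ v, ρ (upper v) (e ψ) = ψ v • e ψ := by
    intro ψ v
    simp only [e, map_sum, map_smul, Finset.smul_sum, smul_smul]
    rw [← Equiv.sum_comp (Equiv.addLeft v) (fun u => (ψ v * ψ (-u)) • ρ (upper u) g)]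
    refine Finset.sum_congr rfl fun u _ => ?_
    rw [← Module.End.mul_apply, ← map_mul, upper_mul, Equiv.coe_addLeft, ← AddChar.map_add_eq_mul]
    congr 2
    simp
  have heE : ∀ ψ, e ψ ∈ E := fun ψ =>
    Submodule.sum_mem _ fun u _ => Submodule.smul_mem _ _ (hE _ _ hgE)
  have hsum : ∑ ψ, e ψ = (Fintype.card F : ℂ) • g := by
    simp only [e]
    rw [Finset.sum_comm]
    simp only [← Finset.sum_smul, AddChar.sum_apply_eq_ite, neg_eq_zero]
    rw [Finset.sum_eq_single 0]
    · simp
    · intro b _ hb; simp [hb]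
    · simp
  by_contra hcon
  push Not at hcon
  have h0 : ∀ ψ, ψ ≠ 1 → e ψ = 0 := by
    intro ψ hψ
    by_contra h
    obtain ⟨u, hu⟩ := (hcon (e ψ) (heE ψ) h).2 ψ hψ
    exact hu (heig ψ u)
  -- With all nontrivial components zero, g is a multiple of its trivial component and hence fixed
  -- by the unipotents, against the choice of `u₀`.
  rw [Finset.sum_eq_single 1 (fun ψ _ hψ => h0 ψ hψ) (by simp)] at hsum
  have h1 := heig 1 u₀
  rw [hsum, AddChar.one_apply, one_smul, map_smul] at h1
  have hN : (Fintype.card F : ℂ) ≠ 0 := by exact_mod_cast Fintype.card_ne_zero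
  exact hne (smul_right_injective V hN h1)

end Matrix.SpecialLinearGroup

/-! ### Coordinatewise eigenvectors and multiplicity -/

open Matrix.SpecialLinearGroup in
/-- The coordinatewise version for a power of `SL(2, F)`. -/
lemma exists_coordwise_fixed_or_eigenvector {F : Type*} [Field F] [Fintype F] {ι : Type*}
    [DecidableEq ι] {V : Type*} [AddCommGroup V] [Module ℂ V]
    (ρ : Representation ℂ (ι → Matrix.SpecialLinearGroup (Fin 2) F) V) (J : Finset ι)
    (E : Submodule ℂ V) (hE : ∀ i ∈ J, ∀ g, ∀ f ∈ E, ρ (Pi.mulSingle i g) f ∈ E)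
    (f : V) (hf : f ∈ E) (hf0 : f ≠ 0) :
    ∃ f' ∈ E, f' ≠ 0 ∧ ∀ i ∈ J, (∀ g, ρ (Pi.mulSingle i g) f' = f') ∨
      ∃ ψ : AddChar F ℂ, ψ ≠ 1 ∧ ∀ u, ρ (Pi.mulSingle i (upper u)) f' = ψ u • f' := by
  induction J using Finset.induction_on generalizing E f with
  | empty => exact ⟨f, hf, hf0, by simp⟩
  | insert i J hi ih =>
    obtain ⟨f₁, hf₁, hf₁0, h⟩ := exists_fixed_or_eigenvector
      (MonoidHom.comp ρ (MonoidHom.mulSingle (fun _ => Matrix.SpecialLinearGroup (Fin 2) F) i)) E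
      (fun g f hf => hE i (Finset.mem_insert_self _ _) g f hf) f hf hf0
    have hcomm : ∀ j ∈ J, ∀ g h v, ρ (Pi.mulSingle i g) (ρ (Pi.mulSingle j h) v) =
        ρ (Pi.mulSingle j h) (ρ (Pi.mulSingle i g) v) := by
      intro j hj g h v
      have hij : i ≠ j := fun e => hi (e ▸ hj)
      rw [← Module.End.mul_apply, ← Module.End.mul_apply, ← map_mul, ← map_mul,
        (Pi.mulSingle_commute (f := fun _ => Matrix.SpecialLinearGroup (Fin 2) F) hij g h).eq]
    rcases h with h | ⟨ψ, hψ, h⟩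
    -- The condition just gained at i is built into a smaller subspace. It stays invariant under the
    -- other coordinates because they commute with coordinate i.
    · let E' : Submodule ℂ V :=
        { carrier := {v | v ∈ E ∧ ∀ g, ρ (Pi.mulSingle i g) v = v}
          add_mem' := fun ha hb => ⟨E.add_mem ha.1 hb.1, fun g => by rw [map_add, ha.2, hb.2]⟩
          zero_mem' := ⟨E.zero_mem, fun g => map_zero _⟩
          smul_mem' := fun c v hv => ⟨E.smul_mem c hv.1, fun g => by rw [map_smul, hv.2]⟩ }
      obtain ⟨f', hf', hf'0, hJ⟩ := ih E'
        (fun j hj g v hv => ⟨hE j (Finset.mem_insert_of_mem hj) g v hv.1,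
          fun g' => by rw [hcomm j hj, hv.2]⟩) f₁ ⟨hf₁, h⟩ hf₁0
      refine ⟨f', hf'.1, hf'0, fun j hj => ?_⟩
      rcases Finset.mem_insert.1 hj with rfl | hj
      · exact Or.inl hf'.2
      · exact hJ j hj
    · let E' : Submodule ℂ V :=
        { carrier := {v | v ∈ E ∧ ∀ u, ρ (Pi.mulSingle i (upper u)) v = ψ u • v}
          add_mem' := fun ha hb => ⟨E.add_mem ha.1 hb.1, fun g => by
            rw [map_add, ha.2, hb.2, smul_add]⟩
          zero_mem' := ⟨E.zero_mem, fun g => by rw [map_zero, smul_zero]⟩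
          smul_mem' := fun c v hv => ⟨E.smul_mem c hv.1, fun g => by
            rw [map_smul, hv.2, smul_comm]⟩ }
      obtain ⟨f', hf', hf'0, hJ⟩ := ih E'
        (fun j hj g v hv => ⟨hE j (Finset.mem_insert_of_mem hj) g v hv.1,
          fun g' => by rw [hcomm j hj, hv.2, map_smul]⟩) f₁ ⟨hf₁, h⟩ hf₁0
      refine ⟨f', hf'.1, hf'0, fun j hj => ?_⟩
      rcases Finset.mem_insert.1 hj with rfl | hj
      · exact Or.inr ⟨ψ, hψ, hf'.2⟩
      · exact hJ j hj

/-- Translation is unitary, so ⟨f, g⟩ = conj(α) β ⟨f, g⟩, and conj(α) β = 1 would force α = β. -/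
lemma inner_eq_zero_of_rightTranslation {G : Type*} [Group G] [Fintype G] (r : G)
    (f g : EuclideanSpace ℂ G) (α β : ℂ) (hα : ‖α‖ = 1) (hne : α ≠ β)
    (hf : rightTranslation r f = α • f) (hg : rightTranslation r g = β • g) :
    inner ℂ f g = 0 := by
  have h := (rightTranslation r).inner_map_map f g
  rw [hf, hg, inner_smul_left, inner_smul_right, ← mul_assoc] at h
  by_contra h0
  have h1 : (starRingEnd ℂ) α * β = 1 := by
    apply mul_right_cancel₀ h0
    rw [h, one_mul]
  apply hne
  have h2 : α * (starRingEnd ℂ) α = 1 := by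
    rw [Complex.mul_conj', hα]; simp
  calc α = α * ((starRingEnd ℂ) α * β) := by rw [h1, mul_one]
    _ = β := by rw [← mul_assoc, h2, one_mul]

/-- The nonzero squares of a finite field. -/
noncomputable def unitSquares (F : Type*) [Field F] [Fintype F] [DecidableEq F] : Finset Fˣ :=
  Finset.univ.image fun a : Fˣ => a ^ 2

/-- Squaring on units has fibres of size at most two; the extra one accounts for zero. -/
lemma card_le_two_mul_card_unitSquares (F : Type*) [Field F] [Fintype F] [DecidableEq F] :
    Fintype.card F ≤ 2 * (unitSquares F).card + 1 := by
  have h1 : (Finset.univ : Finset Fˣ).card ≤ 2 * (unitSquares F).card := by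
    refine Finset.card_le_mul_card_image Finset.univ 2 fun b hb => ?_
    obtain ⟨r, -, rfl⟩ := Finset.mem_image.1 hb
    refine (Finset.card_le_card (t := {r, -r}) fun x hx => ?_).trans Finset.card_le_two
    have := (Finset.mem_filter.1 hx).2
    simp only [Finset.mem_insert, Finset.mem_singleton]
    exact Units.sq_eq_sq_iff_eq_or_eq_neg.1 this
  rw [Finset.card_univ, Fintype.card_units] at h1
  omega

open Matrix.SpecialLinearGroup in
/-- The torus translates of an eigenvector with nontrivial characters in the coordinates in `S`
show that the multiplicity of the eigenvalue is large. -/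
lemma eigenvalue_mul_card_squares_pow_le {F : Type*} [Field F] [Fintype F] [DecidableEq F]
    {ι : Type*} [Fintype ι] [DecidableEq ι]
    (a : (ι → Matrix.SpecialLinearGroup (Fin 2) F) → ℝ) (μ : ℝ)
    (f : EuclideanSpace ℂ (ι → Matrix.SpecialLinearGroup (Fin 2) F)) (hf0 : f ≠ 0)
    (hf : LinearMap.adjoint (convOp a) (convOp a f) = (μ : ℂ) • f) (S : Finset ι)
    (ψ : ι → AddChar F ℂ) (hψ : ∀ i ∈ S, ψ i ≠ 1)
    (hfψ : ∀ i ∈ S, ∀ u, rightTranslation (Pi.mulSingle i (upper u)) f = ψ i u • f) :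
    μ * ((unitSquares F).card : ℝ) ^ S.card ≤
      Fintype.card (ι → Matrix.SpecialLinearGroup (Fin 2) F) * ∑ x, a x ^ 2 := by
  have hroot : ∀ b : unitSquares F, ∃ r : Fˣ, r ^ 2 = b.1 := by
    rintro ⟨b, hb⟩
    obtain ⟨r, -, h⟩ := Finset.mem_image.1 hb
    exact ⟨r, h⟩
  choose root hroot using hroot
  -- One torus element for each choice of a square in every coordinate of S. Conjugation by `torus
  -- r` scales unipotents by r^2, so only the square affects the character.
  let τ : (S → unitSquares F) → ι → Matrix.SpecialLinearGroup (Fin 2) F := fun s i =>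
    if h : i ∈ S then torus (root (s ⟨i, h⟩)) else 1
  have hτ : ∀ s (i : S) u, rightTranslation (Pi.mulSingle i.1 (upper u))
      (rightTranslation (τ s) f) =
      ψ i ((((s i : Fˣ)⁻¹ : Fˣ) : F) * u) • rightTranslation (τ s) f := by
    intro s i u
    have h1 : Pi.mulSingle i.1 (upper u) * τ s =
        τ s * Pi.mulSingle i.1 (upper ((((s i : Fˣ)⁻¹ : Fˣ) : F) * u)) := by
      funext j
      by_cases hj : j = i.1
      · subst hj
        simp only [Pi.mul_apply, Pi.mulSingle_eq_same, τ, dif_pos i.2, upper_mul_torus, hroot]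
      · simp [Pi.mulSingle_eq_of_ne hj]
    rw [← rightTranslation_mul, h1, rightTranslation_mul, hfψ i.1 i.2, map_smul]
  have := eigenvalue_mul_card_le a μ (fun s => rightTranslation (τ s) f)
    (fun s h => hf0 ((rightTranslation (τ s)).map_eq_zero_iff.1 h))
    (fun s => by
      rw [convOp_rightTranslation, adjoint_convOp, convOp_rightTranslation, ← adjoint_convOp, hf,
        map_smul]) ?_
  · simpa using this
  · intro s s' hss
    obtain ⟨i, hi⟩ := Function.ne_iff.1 hss
    -- If v ↦ ψ(xv) and v ↦ ψ(yv) agreed for some x ≠ y, evaluating at v/(x - y) would make ψ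
    -- trivial.
    have : ∃ u : F, ψ i ((((s i : Fˣ)⁻¹ : Fˣ) : F) * u) ≠ ψ i ((((s' i : Fˣ)⁻¹ : Fˣ) : F) * u) := by
      by_contra hcon
      push Not at hcon
      apply hψ i.1 i.2
      have hd : (((s i : Fˣ)⁻¹ : Fˣ) : F) - (((s' i : Fˣ)⁻¹ : Fˣ) : F) ≠ 0 := by
        rw [sub_ne_zero]
        intro h
        exact hi (Subtype.ext (inv_injective (Units.ext h)))
      ext v
      have h := hcon (v / ((((s i : Fˣ)⁻¹ : Fˣ) : F) - (((s' i : Fˣ)⁻¹ : Fˣ) : F)))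
      set x := (((s i : Fˣ)⁻¹ : Fˣ) : F)
      set y := (((s' i : Fˣ)⁻¹ : Fˣ) : F)
      have hv : v = x * (v / (x - y)) + -(y * (v / (x - y))) := by
        field_simp; ring
      rw [hv, AddChar.map_add_eq_mul, h, ← AddChar.map_add_eq_mul, add_neg_cancel,
        AddChar.map_zero_eq_one]
      rfl
    obtain ⟨u, hu⟩ := this
    have hn := AddChar.norm_apply (ψ i.1) ((((s i : Fˣ)⁻¹ : Fˣ) : F) * u)
    exact inner_eq_zero_of_rightTranslation _ _ _ _ _ hn hu (hτ s i u) (hτ s' i u)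

/-- The sum equals ∑ p² - 1/|S|, and ∑ p² ≤ M ∑ p = M. -/
lemma sum_sq_sub_uniform_le {S : Type*} [Fintype S] [Nonempty S] (p : S → ℝ) (h0 : ∀ x, 0 ≤ p x)
    (h1 : ∑ x, p x = 1) (M : ℝ) (hM : ∀ x, p x ≤ M) :
    ∑ x, (p x - 1 / (Fintype.card S : ℝ)) ^ 2 ≤ M := by
  have hN : (Fintype.card S : ℝ) ≠ 0 := by exact_mod_cast Fintype.card_ne_zero
  have h2 : ∑ x, (p x - 1 / (Fintype.card S : ℝ)) ^ 2 =
      ∑ x, p x * p x - 1 / (Fintype.card S : ℝ) := by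
    have : ∀ x, (p x - 1 / (Fintype.card S : ℝ)) ^ 2 = p x * p x -
        p x * (2 / (Fintype.card S : ℝ)) + (1 / (Fintype.card S : ℝ)) ^ 2 := fun x => by ring
    simp only [this, Finset.sum_add_distrib, Finset.sum_sub_distrib, ← Finset.sum_mul, h1]
    simp
    field_simp
    ring
  rw [h2]
  have h3 : ∑ x, p x * p x ≤ ∑ x, p x * M :=
    Finset.sum_le_sum fun x _ => mul_le_mul_of_nonneg_left (hM x) (h0 x)
  rw [← Finset.sum_mul, h1, one_mul] at h3
  have : 0 ≤ 1 / (Fintype.card S : ℝ) := by positivity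
  linarith

/-! ### Marginals and functions of few coordinates -/

open Classical in
/-- The distribution induced by `p` on the coordinates in `I`, for an arbitrary index type. -/
noncomputable def marginal {ι H : Type*} [Fintype ι] [DecidableEq ι] [Fintype H] (p : (ι → H) → ℝ)
    (I : Finset ι) : (I → H) → ℝ :=
  fun y => ∑ x : ι → H with (∀ i : I, x i = y i), p x

section marginal
variable {ι H : Type*} [Fintype ι] [DecidableEq ι] [Fintype H]

open Classical in
lemma marginal_eq_sum_ite (p : (ι → H) → ℝ) (I : Finset ι) (y : I → H) :
    marginal p I y = ∑ x, if (fun i : I => x i) = y then p x else 0 := by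
  rw [marginal, Finset.sum_filter]
  simp only [funext_iff]

open Classical in
lemma sum_mul_comp_restrict (p : (ι → H) → ℝ) (I : Finset ι) {M : Type*} [AddCommGroup M]
    [Module ℝ M] (g : (I → H) → M) :
    ∑ x, p x • g (fun i : I => x i) = ∑ y, marginal p I y • g y := by
  simp only [marginal_eq_sum_ite, Finset.sum_smul, ite_smul, zero_smul]
  rw [Finset.sum_comm]
  refine Finset.sum_congr rfl fun x _ => ?_
  simp

lemma sum_marginal (p : (ι → H) → ℝ) (I : Finset ι) : ∑ y, marginal p I y = ∑ x, p x := by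
  simpa using (sum_mul_comp_restrict p I (fun _ => (1 : ℝ))).symm

lemma marginal_nonneg (p : (ι → H) → ℝ) (hp : ∀ x, 0 ≤ p x) (I : Finset ι) (y : I → H) :
    0 ≤ marginal p I y :=
  Finset.sum_nonneg fun x _ => hp x

lemma le_marginal (p : (ι → H) → ℝ) (hp : ∀ x, 0 ≤ p x) (I : Finset ι) (x : ι → H) :
    p x ≤ marginal p I (fun i : I => x i) :=
  Finset.single_le_sum (f := p) (fun x _ => hp x) (by simp)

lemma marginal_sub (p q : (ι → H) → ℝ) (I : Finset ι) (y : I → H) :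
    marginal (fun x => p x - q x) I y = marginal p I y - marginal q I y := by
  simp [marginal, Finset.sum_sub_distrib]

lemma marginal_const [Nonempty H] (I : Finset ι) (y : I → H) :
    marginal (fun _ : ι → H => 1 / (Fintype.card (ι → H) : ℝ)) I y =
      1 / (Fintype.card (I → H) : ℝ) := by
  classical
  have hN : (Fintype.card H : ℝ) ≠ 0 := by exact_mod_cast Fintype.card_ne_zero
  have h1 : (Finset.univ.filter fun x : ι → H => ∀ i : I, x i = y i) =
      Fintype.piFinset fun i => if h : i ∈ I then {y ⟨i, h⟩} else Finset.univ := by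
    ext x
    simp only [Finset.mem_filter, Finset.mem_univ, true_and, Fintype.mem_piFinset]
    constructor
    · intro h i
      by_cases hi : i ∈ I
      · simpa [hi] using h ⟨i, hi⟩
      · simp [hi]
    · rintro h ⟨i, hi⟩
      simpa [hi] using h i
  have h2 : (Finset.univ.filter fun x : ι → H => ∀ i : I, x i = y i).card =
      Fintype.card H ^ (Fintype.card ι - I.card) := by
    rw [h1, Fintype.card_piFinset, ← Finset.card_compl, ← Finset.prod_const,
      ← Finset.prod_mul_prod_compl I, Finset.prod_eq_one, one_mul]
    · refine Finset.prod_congr rfl fun i hi => ?_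
      rw [dif_neg (Finset.mem_compl.1 hi), Finset.card_univ]
    · intro i hi
      rw [dif_pos hi, Finset.card_singleton]
  have h3 : I.card ≤ Fintype.card ι := Finset.card_le_univ I
  rw [marginal, Finset.sum_const, nsmul_eq_mul]
  simp only [Fintype.card_fun, Fintype.card_coe]
  convert_to (((Finset.univ.filter fun x : ι → H => ∀ i : I, x i = y i).card : ℕ) : ℝ) *
    (1 / ((Fintype.card H ^ Fintype.card ι : ℕ) : ℝ)) = _
  rw [h2]
  push_cast
  rw [← Nat.sub_add_cancel h3, pow_add]
  simp only [Nat.add_sub_cancel]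
  field_simp

end marginal

section marginalGroup
variable {ι H : Type*} [Fintype ι] [DecidableEq ι] [Group H] [Fintype H]

/-- Points that agree on I differ by a right factor supported off I, which is a product of
single-coordinate elements fixing f. -/
lemma apply_eq_of_rightTranslation_fixed (f : EuclideanSpace ℂ (ι → H)) (I : Finset ι)
    (hf : ∀ i ∉ I, ∀ g, rightTranslation (Pi.mulSingle i g) f = f) (x x' : ι → H)
    (h : ∀ i ∈ I, x i = x' i) : f x = f x' := by
  have key : ∀ J : Finset ι, (∀ i ∈ J, i ∉ I) → ∀ w : ι → H, (∀ i ∉ J, w i = 1) →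
      rightTranslation w f = f := by
    intro J
    induction J using Finset.induction_on with
    | empty =>
      intro _ w hw
      rw [show w = 1 from funext fun i => hw i (by simp), rightTranslation_one]
    | insert j J hj ih =>
      intro hJ w hw
      have h1 : w = Function.update w j 1 * Pi.mulSingle j (w j) := by
        funext i
        by_cases hi : i = j
        · subst hi; simp
        · simp [hi]
      rw [h1, rightTranslation_mul, hf j (hJ j (Finset.mem_insert_self _ _))]
      refine ih (fun i hi => hJ i (Finset.mem_insert_of_mem hi)) _ fun i hi => ?_
      by_cases hij : i = j
      · subst hij; simp
      · rw [Function.update_of_ne hij]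
        exact hw i (by simp [hij, hi])
  have h2 := key Iᶜ (by simp) (x⁻¹ * x') (fun i hi => by
    rw [Pi.mul_apply, Pi.inv_apply, h i (by simpa using hi), inv_mul_cancel])
  have h3 := congrArg (fun v : EuclideanSpace ℂ (ι → H) => v x) h2
  simpa using h3.symm

/-- On functions of the coordinates in `I`, convolution is bounded by the marginal on `I`. -/
lemma norm_convOp_le_of_fixed (a : (ι → H) → ℝ) (f : EuclideanSpace ℂ (ι → H)) (I : Finset ι)
    (hf : ∀ i ∉ I, ∀ g, rightTranslation (Pi.mulSingle i g) f = f) (δ : ℝ)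
    (ha : ∀ y, |marginal a I y| ≤ δ / (Fintype.card (I → H) : ℝ)) :
    ‖convOp a f‖ ≤ δ * ‖f‖ := by
  let ext : (I → H) → ι → H := fun y i => if h : i ∈ I then y ⟨i, h⟩ else 1
  have h1 : convOp a f = ∑ y, marginal a I y • leftTranslation (ext y) f := by
    rw [← sum_mul_comp_restrict a I (fun y => leftTranslation (ext y) f), convOp_eq_sum]
    refine Finset.sum_congr rfl fun x _ => ?_
    rw [Complex.coe_smul]
    congr 1
    ext z
    simp only [leftTranslation_apply]
    refine apply_eq_of_rightTranslation_fixed f I hf _ _ fun i hi => ?_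
    simp [ext, hi]
  have hN : (Fintype.card (I → H) : ℝ) ≠ 0 := by exact_mod_cast Fintype.card_ne_zero
  rw [h1]
  calc ‖∑ y, marginal a I y • leftTranslation (ext y) f‖
      ≤ ∑ y, ‖marginal a I y • leftTranslation (ext y) f‖ := norm_sum_le _ _
    _ ≤ ∑ _y : I → H, δ / (Fintype.card (I → H) : ℝ) * ‖f‖ := by
        refine Finset.sum_le_sum fun y _ => ?_
        rw [norm_smul, Real.norm_eq_abs, LinearIsometryEquiv.norm_map]
        exact mul_le_mul_of_nonneg_right (ha y) (norm_nonneg _)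
    _ = δ * ‖f‖ := by
        rw [Finset.sum_const, nsmul_eq_mul, Finset.card_univ]
        field_simp

/-- Restriction to I is a group homomorphism, and pushforward along a homomorphism respects
convolution. -/
lemma marginal_groupConv (p q : (ι → H) → ℝ) (I : Finset ι) :
    marginal (groupConv p q) I = groupConv (marginal p I) (marginal q I) := by
  classical
  funext z
  have h1 : ∀ y : I → H, marginal p I y * marginal q I (y⁻¹ * z) =
      marginal p I y • marginal q I (y⁻¹ * z) := fun _ => rfl
  unfold groupConv
  simp only [h1]
  rw [← sum_mul_comp_restrict p I (fun y => marginal q I (y⁻¹ * z))]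
  simp only [marginal_eq_sum_ite, smul_eq_mul]
  calc _ = ∑ x, ∑ y, p y * (if (fun i : I => x i) = z then q (y⁻¹ * x) else 0) := by
        refine Finset.sum_congr rfl fun x _ => ?_
        split_ifs <;> simp
    _ = _ := by
        rw [Finset.sum_comm]
        refine Finset.sum_congr rfl fun y _ => ?_
        rw [← Finset.mul_sum]
        congr 1
        rw [← Equiv.sum_comp (Equiv.mulLeft y)]
        refine Finset.sum_congr rfl fun x _ => ?_
        have : ((fun i : I => (y * x) i) = z) ↔
            ((fun i : I => x i) = (fun i : I => y i)⁻¹ * z) := by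
          rw [eq_inv_mul_iff_mul_eq]; rfl
        simp only [Equiv.coe_mulLeft, this, inv_mul_cancel_left]

lemma marginal_groupConvPow (p : (ι → H) → ℝ) (I : Finset ι) (n : ℕ) :
    marginal (groupConvPow p n) I = groupConvPow (marginal p I) n := by
  classical
  induction n with
  | zero =>
    funext z
    simp only [groupConvPow, marginal_eq_sum_ite]
    rw [Finset.sum_eq_single 1]
    · simp only [if_true]
      congr 1
      exact propext ⟨fun h => h.symm, fun h => h.symm⟩
    · intro x _ hx
      simp [hx]
    · simp
  | succ n ih => rw [groupConvPow, marginal_groupConv, ih]; rfl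

end marginalGroup

/-! ### Displacement of a function under translations -/

section displacement
variable {G : Type*} [Group G] [Fintype G]

lemma norm_leftTranslation_mul_sub_le (f : EuclideanSpace ℂ G) (g h : G) :
    ‖leftTranslation (g * h) f - f‖ ≤ ‖leftTranslation g f - f‖ + ‖leftTranslation h f - f‖ := by
  have : leftTranslation (g * h) f - f =
      (leftTranslation g f - f) + leftTranslation g (leftTranslation h f - f) := by
    rw [leftTranslation_mul, map_sub]; abel
  rw [this]
  refine (norm_add_le _ _).trans ?_
  rw [LinearIsometryEquiv.norm_map]

lemma norm_leftTranslation_inv_mul_sub (f : EuclideanSpace ℂ G) (g h : G) :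
    ‖leftTranslation (g⁻¹ * h) f - f‖ = ‖leftTranslation g f - leftTranslation h f‖ := by
  have : leftTranslation (g⁻¹ * h) f - f =
      leftTranslation g⁻¹ (leftTranslation h f - leftTranslation g f) := by
    rw [map_sub, ← leftTranslation_mul, ← leftTranslation_mul, inv_mul_cancel, leftTranslation_one]
  rw [this, LinearIsometryEquiv.norm_map, norm_sub_rev]

lemma norm_leftTranslation_inv_sub (f : EuclideanSpace ℂ G) (g : G) :
    ‖leftTranslation g⁻¹ f - f‖ = ‖leftTranslation g f - f‖ := by
  simpa using norm_leftTranslation_inv_mul_sub f g 1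

lemma norm_leftTranslation_conj_sub_le (f : EuclideanSpace ℂ G) (g h : G) :
    ‖leftTranslation (g * h * g⁻¹) f - f‖ ≤
      2 * ‖leftTranslation g f - f‖ + ‖leftTranslation h f - f‖ := by
  have h1 := norm_leftTranslation_mul_sub_le f (g * h) g⁻¹
  have h2 := norm_leftTranslation_mul_sub_le f g h
  rw [norm_leftTranslation_inv_sub] at h1
  linarith

/-- If `f` has mean zero, then some translate is at distance at least `‖f‖` from `f`. -/
lemma norm_le_of_displacement_le (f : EuclideanSpace ℂ G) (hf : ∑ x, f x = 0) (D : ℝ)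
    (hD : ∀ g, ‖leftTranslation g f - f‖ ≤ D) : ‖f‖ ≤ D := by
  have hN : (0 : ℝ) < Fintype.card G := by exact_mod_cast Fintype.card_pos
  have h0 : ∑ g, leftTranslation g f = 0 := by
    ext x
    have : ∑ y : G, f (y⁻¹ * x) = ∑ y, f y :=
      Equiv.sum_comp ((Equiv.inv G).trans (Equiv.mulRight x)) f
    simp [this, hf]
  have h1 : ∑ g : G, (leftTranslation g f - f) = -((Fintype.card G : ℂ) • f) := by
    rw [Finset.sum_sub_distrib, h0]
    simp
    norm_cast
  have h2 : (Fintype.card G : ℝ) * ‖f‖ ≤ Fintype.card G * D := by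
    calc (Fintype.card G : ℝ) * ‖f‖ = ‖∑ g : G, (leftTranslation g f - f)‖ := by
          rw [h1, norm_neg, norm_smul]; simp
      _ ≤ ∑ g : G, ‖leftTranslation g f - f‖ := norm_sum_le _ _
      _ ≤ ∑ _g : G, D := Finset.sum_le_sum fun g _ => hD g
      _ = _ := by simp
  exact le_of_mul_le_mul_left h2 hN

lemma norm_convOp_le_of_nonneg (b : G → ℝ) (hb : ∀ x, 0 ≤ b x) (f : EuclideanSpace ℂ G) :
    ‖convOp b f‖ ≤ (∑ x, b x) * ‖f‖ := by
  rw [convOp_eq_sum, Finset.sum_mul]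
  refine (norm_sum_le _ _).trans (Finset.sum_le_sum fun x _ => ?_)
  rw [norm_smul, LinearIsometryEquiv.norm_map, Complex.norm_real, Real.norm_eq_abs,
    abs_of_nonneg (hb x)]

/-- Two translates in the support that are far apart make convolution contracting. -/
lemma norm_convOp_le_of_far (p : G → ℝ) (hp0 : ∀ x, 0 ≤ p x) (hp1 : ∑ x, p x = 1)
    (f : EuclideanSpace ℂ G) (x y : G) (hxy : x ≠ y) (η s : ℝ) (hη : 0 ≤ η) (hs : 0 ≤ s)
    (hs1 : s ≤ 1) (hx : η ≤ p x) (hy : η ≤ p y)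
    (hd : s * ‖f‖ ≤ ‖leftTranslation x f - leftTranslation y f‖) :
    ‖convOp p f‖ ≤ (1 - η * s ^ 2 / 4) * ‖f‖ := by
  classical
  -- Mass η is removed at x and at y. The remainder contributes at most 1 - 2η, and the two removed
  -- translates partly cancel.
  let b : G → ℝ := fun z => p z - ((if z = x then η else 0) + (if z = y then η else 0))
  have hb : ∀ z, 0 ≤ b z := by
    intro z
    simp only [b]
    by_cases h1 : z = x
    · subst h1; simpa [hxy] using hx
    · by_cases h2 : z = y
      · subst h2; simpa [h1] using hy
      · simpa [h1, h2] using hp0 z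
  have hb1 : ∑ z, b z = 1 - 2 * η := by
    simp [b, Finset.sum_add_distrib, hp1]; ring
  have h1 : convOp p f = (η : ℂ) • (leftTranslation x f + leftTranslation y f) + convOp b f := by
    rw [convOp_eq_sum, convOp_eq_sum]
    simp only [b, Complex.ofReal_sub, Complex.ofReal_add, sub_smul, add_smul,
      Finset.sum_sub_distrib, Finset.sum_add_distrib, smul_add]
    have : ∀ w : G, ∑ z, (((if z = w then η else 0 : ℝ)) : ℂ) • leftTranslation z f =
        (η : ℂ) • leftTranslation w f := by
      intro w
      rw [Finset.sum_eq_single w]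
      · simp
      · intro z _ hz; simp [hz]
      · simp
    rw [this, this]
    abel
  -- By the parallelogram law the square of the left side is at most (4 - s²)‖f‖², which is at most
  -- (2 - s²/4)²‖f‖².
  have h2 : ‖leftTranslation x f + leftTranslation y f‖ ≤ (2 - s ^ 2 / 4) * ‖f‖ := by
    have hpar := parallelogram_law_with_norm ℂ (leftTranslation x f) (leftTranslation y f)
    simp only [LinearIsometryEquiv.norm_map] at hpar
    have hd2 : (s * ‖f‖) * (s * ‖f‖) ≤
        ‖leftTranslation x f - leftTranslation y f‖ * ‖leftTranslation x f - leftTranslation y f‖ :=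
      mul_self_le_mul_self (by positivity) hd
    have hs2 : s ^ 2 ≤ 1 := pow_le_one₀ hs hs1
    refine abs_le_of_sq_le_sq' ?_ (mul_nonneg (by linarith) (norm_nonneg f)) |>.2
    have h4 : 0 ≤ (s ^ 2 * ‖f‖) ^ 2 := sq_nonneg _
    nlinarith
  rw [h1]
  refine (norm_add_le _ _).trans ?_
  rw [norm_smul, Complex.norm_real, Real.norm_eq_abs, abs_of_nonneg hη]
  have h3 := norm_convOp_le_of_nonneg b hb f
  rw [hb1] at h3
  have h4 := mul_le_mul_of_nonneg_left h2 hη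
  linarith

end displacement

/-! ### Spectral gap from full marginals on pairs of coordinates -/

section spread
open Matrix.SpecialLinearGroup
variable {F : Type*} [Field F] [Fintype F] [DecidableEq F] {ι : Type*} [Fintype ι] [DecidableEq ι]

lemma exists_unit_sq_ne_one (hF : 4 ≤ Fintype.card F) : ∃ a : Fˣ, (a : F) ^ 2 ≠ 1 := by
  by_contra h
  push Not at h
  have : (Finset.univ : Finset F) ⊆ {0, 1, -1} := by
    intro x _
    by_cases hx : x = 0
    · simp [hx]
    · have := h (Units.mk0 x hx)
      rw [Units.val_mk0] at this
      rcases sq_eq_one_iff.1 this with h | h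
      all_goals simp [h]
  have := (Finset.card_le_card this).trans Finset.card_le_three
  rw [Finset.card_univ] at this
  omega

/-- If elements of small displacement have arbitrary entries in any two coordinates, then some
element with a prescribed unipotent coordinate that is trivial on `J` has small displacement. -/
lemma exists_upper_displacement_le (hF : 4 ≤ Fintype.card F)
    (f : EuclideanSpace ℂ (ι → Matrix.SpecialLinearGroup (Fin 2) F)) (s : ℝ)
    (hpair : ∀ (i j : ι) (h h' : Matrix.SpecialLinearGroup (Fin 2) F), (i = j → h = h') →
      ∃ g, g i = h ∧ g j = h' ∧ ‖leftTranslation g f - f‖ ≤ s)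
    (i : ι) (J : Finset ι) (hi : i ∉ J) (u : F) :
    ∃ g, g i = upper u ∧ (∀ j ∈ J, g j = 1) ∧
      ‖leftTranslation g f - f‖ ≤ 4 ^ J.card * s := by
  obtain ⟨a, ha⟩ := exists_unit_sq_ne_one hF
  have hs : 0 ≤ s := by
    obtain ⟨g, -, -, h⟩ := hpair i i 1 1 (fun _ => rfl)
    exact (norm_nonneg _).trans h
  induction J using Finset.induction_on generalizing u with
  | empty =>
    obtain ⟨g, hg, -, h⟩ := hpair i i (upper u) (upper u) (fun _ => rfl)
    exact ⟨g, hg, by simp, by simpa using h⟩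
  | insert j J hj ih =>
    have hij : i ≠ j := fun e => hi (e ▸ Finset.mem_insert_self _ _)
    have ha' : (a : F) ^ 2 - 1 ≠ 0 := sub_ne_zero.2 ha
    obtain ⟨c, hci, hcJ, hc⟩ := ih (fun h => hi (Finset.mem_insert_of_mem h))
      (u / ((a : F) ^ 2 - 1))
    obtain ⟨g, hgi, hgj, hg⟩ := hpair i j (torus a) 1 (fun e => absurd e hij)
    -- This commutator is trivial at j, where g is, and on J, where c is. At i the torus scales by
    -- a², so the entry is (a² - 1) · u/(a² - 1) = u. The displacement is at most 2s + 2·4^|J| s.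
    refine ⟨g * c * g⁻¹ * c⁻¹, ?_, ?_, ?_⟩
    · have hinv : (upper (u / ((a : F) ^ 2 - 1)))⁻¹ = upper (-(u / ((a : F) ^ 2 - 1))) := by
        rw [inv_eq_iff_mul_eq_one, upper_mul]; simp
      simp only [Pi.mul_apply, Pi.inv_apply, hgi, hci]
      rw [torus_mul_upper, mul_inv_cancel_right, hinv, upper_mul]
      congr 1
      field_simp
      ring
    · intro l hl
      rcases Finset.mem_insert.1 hl with rfl | hl
      · simp [hgj]
      · simp [hcJ l hl]
    · have h1 := norm_leftTranslation_mul_sub_le f (g * c * g⁻¹) c⁻¹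
      have h2 := norm_leftTranslation_conj_sub_le f g c
      rw [norm_leftTranslation_inv_sub] at h1
      rw [Finset.card_insert_of_notMem hj, pow_succ]
      have h3 : 1 * s ≤ 4 ^ J.card * s :=
        mul_le_mul_of_nonneg_right (one_le_pow₀ (by norm_num)) hs
      linarith

/-- Number of factors needed to write any element of `SL(2, q) ^ t` by elements with two
prescribed coordinates. -/
def wordLength (t : ℕ) : ℝ := 4 * t * (4 ^ t + 2)

/-- Displacement is subadditive. A unipotent in one coordinate costs 4^t s, Weyl conjugation adds 2s
for lower ones, four unipotents give any element of a coordinate, and there are t coordinates. A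
function of mean zero cannot have all displacements below its norm. -/
lemma norm_le_wordLength_mul (hF : 4 ≤ Fintype.card F)
    (f : EuclideanSpace ℂ (ι → Matrix.SpecialLinearGroup (Fin 2) F)) (hf : ∑ x, f x = 0) (s : ℝ)
    (hpair : ∀ (i j : ι) (h h' : Matrix.SpecialLinearGroup (Fin 2) F), (i = j → h = h') →
      ∃ g, g i = h ∧ g j = h' ∧ ‖leftTranslation g f - f‖ ≤ s) :
    ‖f‖ ≤ wordLength (Fintype.card ι) * s := by
  set t := Fintype.card ι with ht
  have hU : ∀ (i : ι) (u : F), ‖leftTranslation (Pi.mulSingle i (upper u)) f - f‖ ≤ 4 ^ t * s := by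
    intro i u
    have hs : 0 ≤ s := by
      obtain ⟨g, -, -, h⟩ := hpair i i 1 1 (fun _ => rfl)
      exact (norm_nonneg _).trans h
    obtain ⟨g, hgi, hgJ, hg⟩ := exists_upper_displacement_le hF f s hpair i (Finset.univ.erase i)
      (by simp) u
    have : g = Pi.mulSingle i (upper u) := by
      funext j
      by_cases hj : j = i
      · subst hj; simp [hgi]
      · simp [hj, hgJ j (by simp [hj])]
    rw [← this]
    refine hg.trans (mul_le_mul_of_nonneg_right (pow_le_pow_right₀ (by norm_num) ?_) hs)
    exact Finset.card_le_univ _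
  have hL : ∀ (i : ι) (u : F),
      ‖leftTranslation (Pi.mulSingle i (lower u)) f - f‖ ≤ (4 ^ t + 2) * s := by
    intro i u
    obtain ⟨g, hgi, -, hg⟩ := hpair i i (weyl F) (weyl F) (fun _ => rfl)
    have : Pi.mulSingle i (lower u) = g * Pi.mulSingle i (upper (-u)) * g⁻¹ := by
      funext j
      by_cases hj : j = i
      · subst hj
        simp [hgi, weyl_conj_upper]
      · simp [hj]
    rw [this]
    have h1 := norm_leftTranslation_conj_sub_le f g (Pi.mulSingle i (upper (-u)))
    have h2 := hU i (-u)
    linarith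
  have hH : ∀ (i : ι) h, ‖leftTranslation (Pi.mulSingle i h) f - f‖ ≤ 4 * (4 ^ t + 2) * s := by
    intro i h
    have hs : 0 ≤ s := by
      obtain ⟨g, -, -, h⟩ := hpair i i 1 1 (fun _ => rfl)
      exact (norm_nonneg _).trans h
    obtain ⟨a, b, c, d, rfl⟩ := exists_eq_upper_lower h
    simp only [Pi.mulSingle_mul]
    have h1 := norm_leftTranslation_mul_sub_le f
      (Pi.mulSingle i (upper a) * Pi.mulSingle i (lower b) * Pi.mulSingle i (upper c))
      (Pi.mulSingle i (lower d))
    have h2 := norm_leftTranslation_mul_sub_le f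
      (Pi.mulSingle i (upper a) * Pi.mulSingle i (lower b)) (Pi.mulSingle i (upper c))
    have h3 := norm_leftTranslation_mul_sub_le f (Pi.mulSingle i (upper a)) (Pi.mulSingle i (lower b))
    have h4 := hU i a
    have h5 := hL i b
    have h6 := hU i c
    have h7 := hL i d
    linarith
  have hJ : ∀ (J : Finset ι) (w : ι → Matrix.SpecialLinearGroup (Fin 2) F), (∀ i ∉ J, w i = 1) →
      ‖leftTranslation w f - f‖ ≤ J.card * (4 * (4 ^ t + 2) * s) := by
    intro J
    induction J using Finset.induction_on with
    | empty =>
      intro w hw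
      rw [show w = 1 from funext fun i => hw i (by simp)]
      simp
    | insert j J hj ih =>
      intro w hw
      have h1 : w = Function.update w j 1 * Pi.mulSingle j (w j) := by
        funext i
        by_cases hi : i = j
        · subst hi; simp
        · simp [hi]
      have h2 := ih (Function.update w j 1) fun i hi => by
        by_cases hij : i = j
        · subst hij; simp
        · rw [Function.update_of_ne hij]
          exact hw i (by simp [hij, hi])
      have h3 := norm_leftTranslation_mul_sub_le f (Function.update w j 1) (Pi.mulSingle j (w j))
      have h4 := hH j (w j)
      rw [← h1] at h3
      rw [Finset.card_insert_of_notMem hj]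
      push_cast
      linarith
  refine norm_le_of_displacement_le f hf _ fun w => ?_
  have h1 := hJ Finset.univ w (by simp)
  rw [Finset.card_univ, ← ht] at h1
  rw [wordLength]
  linarith

/-- The spectral gap of distributions on `H ^ t`, with `H` of order `h`, that have full marginals
on pairs of coordinates. -/
noncomputable def gapConst (h t : ℕ) : ℝ :=
  -- This is η s²/4 from `norm_convOp_le_of_far`, with η the weight from `exists_pattern` and s
  -- chosen so that `wordLength t * s` is at most 1/2.
  1 / (4 * (h : ℝ) ^ t * (h : ℝ) ^ t) * (1 / (2 * (wordLength t + 1))) ^ 2 / 4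

lemma wordLength_nonneg (t : ℕ) : 0 ≤ wordLength t := by unfold wordLength; positivity

lemma gapConst_pos (h t : ℕ) (hh : 0 < h) : 0 < gapConst h t := by
  have := wordLength_nonneg t
  unfold gapConst; positivity

lemma gapConst_le_one (h t : ℕ) (hh : 0 < h) : gapConst h t ≤ 1 := by
  have h0 := wordLength_nonneg t
  have h1 : (1 : ℝ) ≤ (h : ℝ) ^ t := one_le_pow₀ (by exact_mod_cast hh)
  have h2 : 1 / (4 * (h : ℝ) ^ t * (h : ℝ) ^ t) ≤ 1 := by
    rw [div_le_one (by positivity)]; nlinarith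
  have h3 : (1 / (2 * (wordLength t + 1))) ^ 2 ≤ 1 := by
    apply pow_le_one₀ (by positivity)
    rw [div_le_one (by positivity)]; linarith
  unfold gapConst
  have h4 := mul_le_one₀ h2 (by positivity) h3
  linarith

/-- Every pattern on a small set of coordinates is taken by an element of not too small weight. -/
lemma exists_pattern {H : Type*} [Group H] [Fintype H] (p : (ι → H) → ℝ) (k : ℕ) (hk : 2 ≤ k)
    (hkt : k ≤ Fintype.card ι)
    (hp : ∀ I : Finset ι, I.card = k → ∀ y, 1 / (2 * (Fintype.card H : ℝ) ^ k) ≤ marginal p I y)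
    (i j : ι) (h h' : H) (hij : i = j → h = h') :
    ∃ x, x i = h ∧ x j = h' ∧
      1 / (4 * (Fintype.card H : ℝ) ^ (Fintype.card ι) * (Fintype.card H : ℝ) ^ (Fintype.card ι)) ≤
        p x := by
  classical
  have hh : (1 : ℝ) ≤ Fintype.card H := by exact_mod_cast Fintype.card_pos
  obtain ⟨I, hI, -, hIk⟩ := Finset.exists_subsuperset_card_eq (Finset.subset_univ {i, j})
    (Finset.card_le_two.trans hk) (by rwa [Finset.card_univ])
  have hiI : i ∈ I := hI (by simp)
  have hjI : j ∈ I := hI (by simp)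
  have hm := hp I hIk (fun l => if l.1 = i then h else h')
  by_contra hcon
  push Not at hcon
  -- At most h^t points of weight below 1/(4 h^{2t}) carry at most 1/(4 h^t), less than the required
  -- 1/(2 h^k).
  have h1 : marginal p I (fun l => if l.1 = i then h else h') ≤
      1 / (4 * (Fintype.card H : ℝ) ^ (Fintype.card ι)) := by
    rw [marginal]
    calc _ ≤ ∑ x : ι → H with (∀ l : I, x l = if l.1 = i then h else h'),
          1 / (4 * (Fintype.card H : ℝ) ^ (Fintype.card ι) *
            (Fintype.card H : ℝ) ^ (Fintype.card ι)) := by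
          refine Finset.sum_le_sum fun x hx => (hcon x ?_ ?_).le
          · simpa using (Finset.mem_filter.1 hx).2 ⟨i, hiI⟩
          · have h2 := (Finset.mem_filter.1 hx).2 ⟨j, hjI⟩
            by_cases hji : j = i
            · rw [h2, if_pos hji, hij hji.symm]
            · rw [h2, if_neg hji]
      _ ≤ ∑ x : ι → H, 1 / (4 * (Fintype.card H : ℝ) ^ (Fintype.card ι) *
            (Fintype.card H : ℝ) ^ (Fintype.card ι)) :=
          Finset.sum_le_sum_of_subset_of_nonneg (Finset.filter_subset _ _)
            (fun _ _ _ => by positivity)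
      _ = _ := by
          rw [Finset.sum_const, Finset.card_univ, Fintype.card_fun, nsmul_eq_mul]
          push_cast
          field_simp
  have h2 := hm.trans h1
  rw [div_le_div_iff₀ (by positivity) (by positivity)] at h2
  have h3 : (Fintype.card H : ℝ) ^ k ≤ (Fintype.card H : ℝ) ^ (Fintype.card ι) :=
    pow_le_pow_right₀ hh hkt
  have h4 : 0 < (Fintype.card H : ℝ) ^ k := by positivity
  linarith

/-- Otherwise all points of weight at least η move f to nearly the same place. Their quotients x⁻¹y
then realise every pattern on two coordinates with small displacement, contradicting
`norm_le_wordLength_mul`. -/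
lemma norm_convOp_le_gapConst (hF : 4 ≤ Fintype.card F)
    (p : (ι → Matrix.SpecialLinearGroup (Fin 2) F) → ℝ) (hp0 : ∀ x, 0 ≤ p x) (hp1 : ∑ x, p x = 1)
    (k : ℕ) (hk : 2 ≤ k) (hkt : k ≤ Fintype.card ι)
    (hp : ∀ I : Finset ι, I.card = k → ∀ y,
      1 / (2 * (Fintype.card (Matrix.SpecialLinearGroup (Fin 2) F) : ℝ) ^ k) ≤ marginal p I y)
    (f : EuclideanSpace ℂ (ι → Matrix.SpecialLinearGroup (Fin 2) F)) (hf : ∑ x, f x = 0) :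
    ‖convOp p f‖ ≤ (1 - gapConst (Fintype.card (Matrix.SpecialLinearGroup (Fin 2) F))
      (Fintype.card ι)) * ‖f‖ := by
  by_cases hf0 : f = 0
  · simp [hf0]
  have hfn : 0 < ‖f‖ := norm_pos_iff.2 hf0
  set h := Fintype.card (Matrix.SpecialLinearGroup (Fin 2) F)
  set t := Fintype.card ι
  have hK := wordLength_nonneg t
  set η : ℝ := 1 / (4 * (h : ℝ) ^ t * (h : ℝ) ^ t) with hη
  set s : ℝ := 1 / (2 * (wordLength t + 1)) with hs
  have hs0 : 0 < s := by positivity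
  by_cases hfar : ∃ x y, η ≤ p x ∧ η ≤ p y ∧
      s * ‖f‖ ≤ ‖leftTranslation x f - leftTranslation y f‖
  · obtain ⟨x, y, hx, hy, hd⟩ := hfar
    have hxy : x ≠ y := by
      rintro rfl
      rw [sub_self, norm_zero] at hd
      exact absurd hd (not_le.2 (by positivity))
    have hs1 : s ≤ 1 := by
      rw [hs, div_le_one (by positivity)]; linarith
    exact norm_convOp_le_of_far p hp0 hp1 f x y hxy η s (by positivity) hs0.le hs1 hx hy hd
  · push Not at hfar
    exfalso
    have h1 := norm_le_wordLength_mul hF f hf (s * ‖f‖) (by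
      intro i j a a' haa
      obtain ⟨x, hxi, hxj, hx⟩ := exists_pattern p k hk hkt hp i j 1 1 (fun _ => rfl)
      obtain ⟨y, hyi, hyj, hy⟩ := exists_pattern p k hk hkt hp i j a a' haa
      refine ⟨x⁻¹ * y, by simp [hxi, hyi], by simp [hxj, hyj], ?_⟩
      rw [norm_leftTranslation_inv_mul_sub]
      exact (hfar x y hx hy).le)
    have h2 : wordLength t * s ≤ 1 / 2 := by
      rw [hs, mul_one_div, div_le_div_iff₀ (by positivity) (by norm_num)]
      linarith
    rw [← mul_assoc] at h1
    have h3 := mul_le_mul_of_nonneg_right h2 hfn.le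
    linarith

end spread

/-! ### The dichotomy for eigenvalues -/

open Matrix.SpecialLinearGroup in
/-- Bounds for the eigenvalues of `T* T`, where `T` is convolution by `p` minus the uniform
distribution. -/
lemma eigenvalue_bounds {F : Type*} [Field F] [Fintype F] [DecidableEq F]
    (hF : 4 ≤ Fintype.card F) {ι : Type*} [Fintype ι] [DecidableEq ι] (k : ℕ) (hk : 2 ≤ k)
    (hkt : k ≤ Fintype.card ι) (p : (ι → Matrix.SpecialLinearGroup (Fin 2) F) → ℝ)
    (hp0 : ∀ x, 0 ≤ p x) (hp1 : ∑ x, p x = 1)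
    (hp : ∀ I : Finset ι, I.card = k → IsEpsUniform
      (((Fintype.card (Matrix.SpecialLinearGroup (Fin 2) F) : ℝ) ^ k)⁻¹) (marginal p I))
    (μ : ℝ) (f : EuclideanSpace ℂ (ι → Matrix.SpecialLinearGroup (Fin 2) F)) (hf0 : f ≠ 0)
    (hf : LinearMap.adjoint (convOp fun x => p x -
        1 / (Fintype.card (ι → Matrix.SpecialLinearGroup (Fin 2) F) : ℝ))
      (convOp (fun x => p x -
        1 / (Fintype.card (ι → Matrix.SpecialLinearGroup (Fin 2) F) : ℝ)) f) = (μ : ℂ) • f) :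
    0 ≤ μ ∧ (μ ≤ (((Fintype.card (Matrix.SpecialLinearGroup (Fin 2) F) : ℝ) ^ k)⁻¹) ^ 2 ∨
      (μ ≤ 1 - gapConst (Fintype.card (Matrix.SpecialLinearGroup (Fin 2) F)) (Fintype.card ι) ∧
        μ * ((unitSquares F).card : ℝ) ^ (k + 1) ≤
          2 * (Fintype.card (Matrix.SpecialLinearGroup (Fin 2) F) : ℝ) ^ (Fintype.card ι - k))) := by
  have hqh := le_card_fin_two (F := F)
  set h := Fintype.card (Matrix.SpecialLinearGroup (Fin 2) F) with hh
  set t := Fintype.card ι with ht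
  have hh4 : (4 : ℝ) ≤ h := by exact_mod_cast hF.trans hqh
  set a : (ι → Matrix.SpecialLinearGroup (Fin 2) F) → ℝ := fun x => p x -
    1 / (Fintype.card (ι → Matrix.SpecialLinearGroup (Fin 2) F) : ℝ) with ha
  have hμ0 : 0 ≤ μ := by
    have h1 := norm_sq_of_adjoint_apply (convOp a) μ f hf
    have h2 : 0 < ‖f‖ ^ 2 := by have := norm_pos_iff.2 hf0; positivity
    by_contra hneg
    have h3 := mul_neg_of_neg_of_pos (not_le.1 hneg) h2
    have h4 : 0 ≤ ‖convOp a f‖ ^ 2 := by positivity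
    linarith
  refine ⟨hμ0, ?_⟩
  have hcardI : ∀ I : Finset ι, I.card = k →
      (Fintype.card (I → Matrix.SpecialLinearGroup (Fin 2) F) : ℝ) = (h : ℝ) ^ k := by
    intro I hI
    rw [Fintype.card_fun, Fintype.card_coe, hI]; push_cast; rfl
  have hhk : (4 : ℝ) ≤ (h : ℝ) ^ k := by
    calc (4 : ℝ) ≤ h := hh4
      _ ≤ (h : ℝ) ^ k := le_self_pow₀ (by linarith) (by omega)
  have hε : ((h : ℝ) ^ k)⁻¹ ≤ 1 / 2 := by
    rw [inv_le_comm₀ (by positivity) (by norm_num)]; linarith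
  let E : Submodule ℂ (EuclideanSpace ℂ (ι → Matrix.SpecialLinearGroup (Fin 2) F)) :=
    LinearMap.eqLocus (LinearMap.adjoint (convOp a) ∘ₗ convOp a) ((μ : ℂ) • LinearMap.id)
  obtain ⟨g, hgE, hg0, hg⟩ := exists_coordwise_fixed_or_eigenvector (rightRegular _) Finset.univ E
    (by
      intro i _ x v hv
      have hv : LinearMap.adjoint (convOp a) (convOp a v) = (μ : ℂ) • v := hv
      change LinearMap.adjoint (convOp a) (convOp a (rightTranslation _ v)) =
        (μ : ℂ) • rightTranslation _ v
      rw [convOp_rightTranslation, adjoint_convOp, convOp_rightTranslation, ← adjoint_convOp, hv,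
        map_smul])
    f hf hf0
  have hgE : LinearMap.adjoint (convOp a) (convOp a g) = (μ : ℂ) • g := hgE
  have hnorm := norm_sq_of_adjoint_apply (convOp a) μ g hgE
  have hgn : 0 < ‖g‖ := norm_pos_iff.2 hg0
  simp only [Finset.mem_univ, true_implies, rightRegular_apply] at hg
  classical
  let S : Finset ι := Finset.univ.filter fun i => ¬ ∀ x, rightTranslation (Pi.mulSingle i x) g = g
  have hS : ∀ i ∉ S, ∀ x, rightTranslation (Pi.mulSingle i x) g = g := by
    intro i hi
    simpa [S] using hi
  have hS' : ∀ i, ∃ ψ : AddChar F ℂ, i ∈ S → ψ ≠ 1 ∧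
      ∀ u, rightTranslation (Pi.mulSingle i (upper u)) g = ψ u • g := by
    intro i
    by_cases hi : i ∈ S
    · have h1 := (hg i).resolve_left (by simpa [S] using hi)
      obtain ⟨ψ, h2⟩ := h1
      exact ⟨ψ, fun _ => h2⟩
    · exact ⟨1, fun h => absurd h hi⟩
  choose ψ hψ using hS'
  -- Few active coordinates: the marginal on k coordinates containing S controls T. Many: both the
  -- gap and the multiplicity bound apply.
  by_cases hSk : S.card ≤ k
  · left
    obtain ⟨I, hSI, -, hI⟩ := Finset.exists_subsuperset_card_eq (Finset.subset_univ S) hSk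
      (by rwa [Finset.card_univ])
    have h1 := norm_convOp_le_of_fixed a g I (fun i hi => hS i fun h => hi (hSI h))
      (((h : ℝ) ^ k)⁻¹) (fun y => by
        rw [ha, marginal_sub, marginal_const]
        exact hp I hI y)
    have h2 := pow_le_pow_left₀ (norm_nonneg _) h1 2
    rw [hnorm, mul_pow] at h2
    exact le_of_mul_le_mul_right h2 (by positivity)
  · right
    push Not at hSk
    constructor
    · obtain ⟨i, hi⟩ : S.Nonempty := Finset.card_pos.1 (by omega)
      obtain ⟨u, hu⟩ := AddChar.ne_one_iff.1 (hψ i hi).1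
      -- Translation preserves the sum but multiplies it by a character value other than 1. On mean
      -- zero functions p and p - u act alike.
      have hmean : ∑ x, g x = 0 := by
        have h1 : ∑ x, rightTranslation (Pi.mulSingle i (upper u)) g x = ∑ x, g x := by
          simp only [rightTranslation_apply]
          exact Equiv.sum_comp (Equiv.mulRight _) g
        rw [(hψ i hi).2 u] at h1
        simp only [PiLp.smul_apply, smul_eq_mul, ← Finset.mul_sum] at h1
        by_contra hne
        exact hu (mul_right_cancel₀ hne (by rw [h1, one_mul]))
      have h1 : convOp a g = convOp p g := by
        rw [ha, convOp_sub, convOp_const_eq_zero _ _ hmean, sub_zero]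
      have h2 := norm_convOp_le_gapConst hF p hp0 hp1 k hk hkt (fun I hI y => by
        have h3 := (abs_le.1 (hp I hI y)).1
        rw [hcardI I hI] at h3
        have h4 : ((h : ℝ) ^ k)⁻¹ / (h : ℝ) ^ k ≤ 1 / 2 / (h : ℝ) ^ k :=
          div_le_div_of_nonneg_right hε (by positivity)
        have h5 : 1 / (2 * (h : ℝ) ^ k) = 1 / (h : ℝ) ^ k - 1 / 2 / (h : ℝ) ^ k := by
          field_simp; norm_num
        rw [h5]
        linarith) g hmean
      rw [← h1] at h2
      have h3 := pow_le_pow_left₀ (norm_nonneg _) h2 2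
      rw [hnorm, mul_pow] at h3
      have h4 := le_of_mul_le_mul_right h3 (by positivity)
      have h5 := (gapConst_pos h t (by rw [hh]; exact Fintype.card_pos)).le
      have h6 := gapConst_le_one h t (by rw [hh]; exact Fintype.card_pos)
      refine h4.trans ?_
      nlinarith
    · have h1 := eigenvalue_mul_card_squares_pow_le a μ g hg0 hgE S ψ (fun i hi => (hψ i hi).1)
        (fun i hi => (hψ i hi).2)
      have hM : ∀ x, p x ≤ 2 / (h : ℝ) ^ k := by
        intro x
        obtain ⟨I, -, hI⟩ := Finset.exists_subset_card_eq (s := (Finset.univ : Finset ι))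
          (n := k) (by rwa [Finset.card_univ])
        have h2 := (abs_le.1 (hp I hI (fun i => x i))).2
        rw [hcardI I hI] at h2
        have h3 := le_marginal p hp0 I x
        have h4 : ((h : ℝ) ^ k)⁻¹ / (h : ℝ) ^ k ≤ 1 / (h : ℝ) ^ k :=
          div_le_div_of_nonneg_right (by linarith) (by positivity)
        have h5 : 2 / (h : ℝ) ^ k = 1 / (h : ℝ) ^ k + 1 / (h : ℝ) ^ k := by ring
        linarith
      have h2 := sum_sq_sub_uniform_le p hp0 hp1 _ hM
      have h3 : (Fintype.card (ι → Matrix.SpecialLinearGroup (Fin 2) F) : ℝ) = (h : ℝ) ^ t := by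
        rw [Fintype.card_fun]; push_cast; rfl
      have hd : (1 : ℝ) ≤ (unitSquares F).card := by
        have := card_le_two_mul_card_unitSquares F
        exact_mod_cast (by omega : 1 ≤ (unitSquares F).card)
      calc μ * ((unitSquares F).card : ℝ) ^ (k + 1)
          ≤ μ * ((unitSquares F).card : ℝ) ^ S.card :=
            mul_le_mul_of_nonneg_left (pow_le_pow_right₀ hd hSk) hμ0
        _ ≤ _ := h1
        _ ≤ (Fintype.card (ι → Matrix.SpecialLinearGroup (Fin 2) F) : ℝ) * (2 / (h : ℝ) ^ k) :=
            mul_le_mul_of_nonneg_left h2 (by positivity)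
        _ = 2 * (h : ℝ) ^ (t - k) := by
            rw [h3, pow_sub₀ _ (by positivity) hkt]; ring

/-! ### Numerical estimates for the eigenvalues -/

/-- A minimum of finitely many positive numbers. -/
lemma exists_gapConst_lower_bound (A B : ℕ) :
    ∃ δ : ℝ, 0 < δ ∧ δ ≤ 1 ∧ ∀ h t : ℕ, 0 < h → h ≤ A → t ≤ B → δ ≤ gapConst h t := by
  by_cases hA : 0 < A
  · obtain ⟨⟨h₀, t₀⟩, hmem, hmin⟩ := (Finset.Icc 1 A ×ˢ Finset.range (B + 1)).exists_min_image
      (fun x => gapConst x.1 x.2) ⟨(1, 0), by simp; omega⟩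
    have h0 : 0 < h₀ := by
      simp only [Finset.mem_product, Finset.mem_Icc] at hmem; omega
    refine ⟨gapConst h₀ t₀, gapConst_pos _ _ h0, gapConst_le_one _ _ h0, fun h t hh hA hB => ?_⟩
    exact hmin (h, t) (by simp; omega)
  · exact ⟨1, one_pos, le_rfl, fun h t hh hhA _ => by omega⟩

/-- A large power of each eigenvalue is at most `h ^ (-k)`. -/
lemma exists_eigenvalue_pow_bound :
    ∃ α : ℕ, 0 < α ∧ ∀ (q h k t d : ℕ) (μ : ℝ), 4 ≤ q → q ≤ h → h ≤ q ^ 3 → q ≤ 2 * d + 1 →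
      3 ≤ k → k ≤ t → 144 * t < 145 * k + 144 → 0 ≤ μ →
      (μ ≤ (((h : ℝ) ^ k)⁻¹) ^ 2 ∨
        (μ ≤ 1 - gapConst h t ∧ μ * (d : ℝ) ^ (k + 1) ≤ 2 * (h : ℝ) ^ (t - k))) →
      μ ^ α ≤ ((h : ℝ) ^ k)⁻¹ := by
  obtain ⟨H₀, hH₀⟩ : ∃ H₀ : ℕ, H₀ = 2 ^ 48 := ⟨_, rfl⟩
  have hH₀pos : 0 < H₀ := by rw [hH₀]; positivity
  obtain ⟨δ, hδ0, hδ1, hδ⟩ := exists_gapConst_lower_bound H₀ 146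
  obtain ⟨n, hn⟩ := exists_pow_lt_of_lt_one (y := 1 - δ) (x := ((H₀ : ℝ) ^ 144)⁻¹)
    (by positivity) (by linarith)
  refine ⟨n + 144, by omega, fun q h k t d μ hq hqh hhq hqd hk hkt ht hμ0 hμ => ?_⟩
  have hh1 : (1 : ℝ) ≤ h := by exact_mod_cast (by omega : 1 ≤ h)
  have hhk : (1 : ℝ) ≤ (h : ℝ) ^ k := one_le_pow₀ hh1
  have hinv : ((h : ℝ) ^ k)⁻¹ ≤ 1 := inv_le_one_of_one_le₀ hhk
  rcases hμ with hμ | ⟨hgap, hmul⟩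
  · have hε2 : (((h : ℝ) ^ k)⁻¹) ^ 2 ≤ ((h : ℝ) ^ k)⁻¹ :=
      pow_le_of_le_one (by positivity) hinv (by norm_num)
    have hμ1 : μ ≤ 1 := hμ.trans (hε2.trans hinv)
    exact (pow_le_of_le_one hμ0 hμ1 (by omega)).trans (hμ.trans hε2)
  have hμ1 : μ ≤ 1 := hgap.trans (by linarith [gapConst_pos h t (by omega)])
  -- Here h ≤ q^3 ≤ 2^48 and t ≤ 146, so a uniform gap δ applies. In the other cases the
  -- multiplicity bound alone gives μ^144 ≤ h^{-k}.
  by_cases hsmall : q < 2 ^ 16 ∧ k < 144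
  · have h1 : h ≤ H₀ := by
      rw [hH₀]
      calc h ≤ q ^ 3 := hhq
        _ ≤ (2 ^ 16) ^ 3 := Nat.pow_le_pow_left hsmall.1.le 3
        _ = 2 ^ 48 := by norm_num
    have h2 := hδ h t (by omega) h1 (by omega)
    calc μ ^ (n + 144) ≤ μ ^ n := pow_le_pow_of_le_one hμ0 hμ1 (by omega)
      _ ≤ (1 - δ) ^ n := pow_le_pow_left₀ hμ0 (by linarith) n
      _ ≤ ((H₀ : ℝ) ^ 144)⁻¹ := hn.le
      _ ≤ ((h : ℝ) ^ k)⁻¹ := by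
        apply inv_anti₀ (by positivity)
        calc (h : ℝ) ^ k ≤ (h : ℝ) ^ 144 := pow_le_pow_right₀ hh1 (by omega)
          _ ≤ (H₀ : ℝ) ^ 144 := pow_le_pow_left₀ (by positivity) (by exact_mod_cast h1) _
  refine (pow_le_pow_of_le_one hμ0 hμ1 (by omega : 144 ≤ n + 144)).trans ?_
  rw [← one_div, le_div_iff₀ (by positivity)]
  obtain ⟨r, rfl⟩ := Nat.exists_eq_add_of_le hkt
  rw [Nat.add_sub_cancel_left] at hmul
  by_cases hq16 : q < 2 ^ 16
  · have hk144 : 144 ≤ k := by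
      by_contra hlt
      exact hsmall ⟨hq16, by omega⟩
    have h48 : (h : ℝ) ≤ 2 ^ 48 := by
      have : h ≤ 2 ^ 48 := by
        calc h ≤ q ^ 3 := hhq
          _ ≤ (2 ^ 16) ^ 3 := Nat.pow_le_pow_left hq16.le 3
          _ = 2 ^ 48 := by norm_num
      exact_mod_cast this
    have hd2 : (2 : ℝ) ≤ d := by exact_mod_cast (by omega : 2 ≤ d)
    have h1 : μ * 2 ^ k ≤ (h : ℝ) ^ r := by
      have h2 : μ * 2 ^ (k + 1) ≤ μ * (d : ℝ) ^ (k + 1) :=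
        mul_le_mul_of_nonneg_left (pow_le_pow_left₀ (by norm_num) hd2 _) hμ0
      rw [pow_succ] at h2
      linarith
    have h2 : μ ^ 144 * 2 ^ (144 * k) ≤ (h : ℝ) ^ (2 * k) := by
      calc μ ^ 144 * 2 ^ (144 * k) = (μ * 2 ^ k) ^ 144 := by
            rw [mul_pow, ← pow_mul, mul_comm k]
        _ ≤ ((h : ℝ) ^ r) ^ 144 := pow_le_pow_left₀ (by positivity) h1 _
        _ = (h : ℝ) ^ (r * 144) := by rw [← pow_mul]
        -- With r = t - k the hypothesis reads 144 r < k + 144, which is at most 2k since k ≥ 144.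
        _ ≤ (h : ℝ) ^ (2 * k) := pow_le_pow_right₀ hh1 (by omega)
    have h3 : (h : ℝ) ^ (3 * k) ≤ 2 ^ (144 * k) := by
      calc (h : ℝ) ^ (3 * k) ≤ (2 ^ 48) ^ (3 * k) := pow_le_pow_left₀ (by positivity) h48 _
        _ = 2 ^ (144 * k) := by rw [← pow_mul]; congr 1; ring
    have h4 : (0 : ℝ) < 2 ^ (144 * k) := by positivity
    refine le_of_mul_le_mul_right ?_ h4
    calc μ ^ 144 * (h : ℝ) ^ k * 2 ^ (144 * k) = μ ^ 144 * 2 ^ (144 * k) * (h : ℝ) ^ k := by ring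
      _ ≤ (h : ℝ) ^ (2 * k) * (h : ℝ) ^ k := mul_le_mul_of_nonneg_right h2 (by positivity)
      _ = (h : ℝ) ^ (3 * k) := by rw [← pow_add]; congr 1; ring
      _ ≤ _ := by rw [one_mul]; exact h3
  · have hq16' : (2 : ℝ) ^ 16 ≤ q := by exact_mod_cast not_lt.1 hq16
    have hq1 : (1 : ℝ) ≤ q := by exact_mod_cast (by omega : 1 ≤ q)
    have hhq' : (h : ℝ) ≤ (q : ℝ) ^ 3 := by exact_mod_cast hhq
    have hd4 : (q : ℝ) ≤ 4 * d := by exact_mod_cast (by omega : q ≤ 4 * d)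
    have h1 : μ * (q : ℝ) ^ (k + 1) ≤ 2 ^ (2 * (k + 1) + 1) * (h : ℝ) ^ r := by
      calc μ * (q : ℝ) ^ (k + 1) ≤ μ * (4 * d : ℝ) ^ (k + 1) :=
            mul_le_mul_of_nonneg_left (pow_le_pow_left₀ (by positivity) hd4 _) hμ0
        _ = 4 ^ (k + 1) * (μ * (d : ℝ) ^ (k + 1)) := by rw [mul_pow]; ring
        _ ≤ 4 ^ (k + 1) * (2 * (h : ℝ) ^ r) := mul_le_mul_of_nonneg_left hmul (by positivity)
        _ = 2 ^ (2 * (k + 1) + 1) * (h : ℝ) ^ r := by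
            rw [pow_succ 2 (2 * (k + 1)), pow_mul]; norm_num [mul_assoc]
    have h2 : μ ^ 144 * (q : ℝ) ^ (144 * (k + 1)) ≤
        2 ^ (144 * (2 * (k + 1) + 1)) * (h : ℝ) ^ (144 * r) := by
      have h3 := pow_le_pow_left₀ (by positivity) h1 144
      rw [mul_pow, mul_pow, ← pow_mul, ← pow_mul, ← pow_mul] at h3
      rwa [mul_comm 144 (k + 1), mul_comm 144 (2 * (k + 1) + 1), mul_comm 144 r]
    have h3 : (h : ℝ) ^ (144 * r + k) ≤ (q : ℝ) ^ (6 * k + 432) := by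
      calc (h : ℝ) ^ (144 * r + k) ≤ (h : ℝ) ^ (2 * k + 144) := pow_le_pow_right₀ hh1 (by omega)
        _ ≤ ((q : ℝ) ^ 3) ^ (2 * k + 144) := pow_le_pow_left₀ (by positivity) hhq' _
        _ = (q : ℝ) ^ (6 * k + 432) := by rw [← pow_mul]; congr 1; ring
    have h4 : (2 : ℝ) ^ (144 * (2 * (k + 1) + 1)) ≤ (q : ℝ) ^ (27 * k) := by
      calc (2 : ℝ) ^ (144 * (2 * (k + 1) + 1)) ≤ 2 ^ (16 * (27 * k)) :=
            pow_le_pow_right₀ (by norm_num) (by omega)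
        _ = (2 ^ 16) ^ (27 * k) := by rw [pow_mul]
        _ ≤ (q : ℝ) ^ (27 * k) := pow_le_pow_left₀ (by norm_num) hq16' _
    have h5 : (0 : ℝ) < (q : ℝ) ^ (144 * (k + 1)) := by positivity
    refine le_of_mul_le_mul_right ?_ h5
    calc μ ^ 144 * (h : ℝ) ^ k * (q : ℝ) ^ (144 * (k + 1))
        = μ ^ 144 * (q : ℝ) ^ (144 * (k + 1)) * (h : ℝ) ^ k := by ring
      _ ≤ 2 ^ (144 * (2 * (k + 1) + 1)) * (h : ℝ) ^ (144 * r) * (h : ℝ) ^ k :=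
          mul_le_mul_of_nonneg_right h2 (by positivity)
      _ = 2 ^ (144 * (2 * (k + 1) + 1)) * (h : ℝ) ^ (144 * r + k) := by rw [pow_add, mul_assoc]
      _ ≤ (q : ℝ) ^ (27 * k) * (q : ℝ) ^ (6 * k + 432) :=
          mul_le_mul h4 h3 (by positivity) (by positivity)
      _ = (q : ℝ) ^ (33 * k + 432) := by
          rw [← pow_add, show 27 * k + (6 * k + 432) = 33 * k + 432 by omega]
      -- This needs 288 ≤ 111 k, hence k ≥ 3: for small k the exponent k + 1 ≥ 4 of q must beat h ≤
      -- q^3.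
      _ ≤ (q : ℝ) ^ (144 * (k + 1)) := pow_le_pow_right₀ hq1 (by omega)
      _ = _ := (one_mul _).symm

/-! ### Conclusion -/

/-- Marginals of a marginal are marginals. -/
lemma isEpsUniform_marginal_marginal {ι H : Type*} [Fintype ι] [DecidableEq ι] [Fintype H]
    (p : (ι → H) → ℝ) (I : Finset ι) (J : Finset I) (ε : ℝ)
    (hp : IsEpsUniform ε (marginal p (J.map (Function.Embedding.subtype _)))) :
    IsEpsUniform ε (marginal (marginal p I) J) := by
  classical
  intro y
  have hmem : ∀ l : J.map (Function.Embedding.subtype (· ∈ I)), ∃ h : l.1 ∈ I, ⟨l.1, h⟩ ∈ J := by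
    rintro ⟨l, hl⟩
    obtain ⟨j, hj, rfl⟩ := Finset.mem_map.1 hl
    exact ⟨j.2, hj⟩
  have h1 : marginal (marginal p I) J y =
      marginal p (J.map (Function.Embedding.subtype _))
        (fun l => y ⟨⟨l.1, (hmem l).1⟩, (hmem l).2⟩) := by
    rw [marginal_eq_sum_ite, marginal_eq_sum_ite]
    have h2 := sum_mul_comp_restrict p I (fun z => if (fun j : J => z j) = y then (1 : ℝ) else 0)
    simp only [smul_eq_mul, mul_ite, mul_one, mul_zero] at h2
    rw [← h2]
    refine Finset.sum_congr rfl fun x _ => ?_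
    refine if_congr ?_ rfl rfl
    simp only [funext_iff]
    constructor
    · intro h l
      exact h ⟨⟨l.1, (hmem l).1⟩, (hmem l).2⟩
    · intro h j
      exact h ⟨j.1.1, Finset.mem_map.2 ⟨j.1, j.2, rfl⟩⟩
  have h2 : Fintype.card (J → H) =
      Fintype.card (J.map (Function.Embedding.subtype (· ∈ I)) → H) := by
    rw [Fintype.card_fun, Fintype.card_fun, Fintype.card_coe, Fintype.card_coe, Finset.card_map]
  rw [h1, h2]
  exact hp _

/-- Convolution powers of an almost `k`-uniform distribution on `SL(2, q) ^ t` are almost uniform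
if `t` is at most slightly larger than `k`. -/
lemma exists_groupConvPow_uniform :
    ∃ n : ℕ, 0 < n ∧ ∀ (F : Type) [Field F] [Fintype F] [DecidableEq F], 4 ≤ Fintype.card F →
      ∀ (ι : Type) [Fintype ι] [DecidableEq ι] (k m : ℕ), 3 ≤ k → k ≤ Fintype.card ι →
      Fintype.card ι ≤ m → 144 * m < 145 * k + 144 →
      ∀ p : (ι → Matrix.SpecialLinearGroup (Fin 2) F) → ℝ, (∀ x, 0 ≤ p x) → ∑ x, p x = 1 →
      (∀ I : Finset ι, I.card = k → IsEpsUniform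
        (((Fintype.card (Matrix.SpecialLinearGroup (Fin 2) F) : ℝ) ^ k)⁻¹) (marginal p I)) →
      IsEpsUniform (((Fintype.card (Matrix.SpecialLinearGroup (Fin 2) F) : ℝ) ^ m)⁻¹)
        (groupConvPow p n) := by
  obtain ⟨α, hα0, hα⟩ := exists_eigenvalue_pow_bound
  -- The power 8α gives squared error h^{-8k}, so error h^{-4k}. The target is h^{-(m+t)}, and m + t
  -- ≤ 2m ≤ 4k.
  refine ⟨α * 8, by omega, fun F _ _ _ hF ι _ _ k m hk hkt htm hm p hp0 hp1 hp => ?_⟩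
  have hqh := Matrix.SpecialLinearGroup.le_card_fin_two (F := F)
  have hhq := Matrix.SpecialLinearGroup.card_fin_two_le (F := F)
  have heig := eigenvalue_bounds hF k (by omega) hkt p hp0 hp1 hp
  set h := Fintype.card (Matrix.SpecialLinearGroup (Fin 2) F) with hh
  set t := Fintype.card ι with ht
  have hh1 : (1 : ℝ) ≤ h := by exact_mod_cast (by omega : 1 ≤ h)
  set X : ℝ := ((h : ℝ) ^ k)⁻¹ with hX
  have hX0 : 0 ≤ X := by positivity
  set B : ℝ := X ^ ((α : ℝ)⁻¹) with hB
  have hB0 : 0 ≤ B := by positivity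
  have hBα : B ^ α = X := Real.rpow_inv_natCast_pow hX0 (by omega)
  have hTB := norm_sq_apply_le_of_eigenvalues (convOp fun x => p x -
      1 / (Fintype.card (ι → Matrix.SpecialLinearGroup (Fin 2) F) : ℝ)) B (by
    intro μ f hf0 hf
    obtain ⟨hμ0, hμ⟩ := heig μ f hf0 hf
    have h1 := hα (Fintype.card F) h k t (unitSquares F).card μ hF hqh hhq
      (card_le_two_mul_card_unitSquares F) hk hkt (by omega) hμ0 hμ
    rw [← hX, ← hBα] at h1
    exact le_of_pow_le_pow_left₀ (by omega) hB0 h1)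
  intro x
  have h1 := groupConvPow_sub_sq_le p hp1 B hB0 hTB (α * 8 - 1) x
  rw [Nat.sub_add_cancel (by omega), pow_mul, hBα] at h1
  have h2 : X ^ 8 = (((h : ℝ) ^ (4 * k))⁻¹) ^ 2 := by
    rw [hX, inv_pow, inv_pow, ← pow_mul, ← pow_mul]; congr 2; ring
  rw [h2] at h1
  have h3 := abs_le_of_sq_le_sq h1 (by positivity)
  have h4 : (Fintype.card (ι → Matrix.SpecialLinearGroup (Fin 2) F) : ℝ) = (h : ℝ) ^ t := by
    rw [Fintype.card_fun]; push_cast; rfl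
  refine h3.trans ?_
  rw [h4, div_eq_mul_inv, ← mul_inv, ← pow_add]
  exact inv_anti₀ (by positivity) (pow_le_pow_right₀ hh1 (by omega))

theorem mainTheorem4 :
    ∃ (c : ℝ) (n : ℕ), 0 < c ∧ 0 < n ∧
      ∀ (F : Type) [Field F] [Fintype F] [DecidableEq F], 4 ≤ Fintype.card F →
      ∀ (k t m : ℕ), 3 ≤ k → k ≤ t → m = ⌈(1 + c) * (k : ℝ)⌉₊ →
      ∀ p : (Fin t → Matrix.SpecialLinearGroup (Fin 2) F) → ℝ,
        p ∈ stdSimplex ℝ (Fin t → Matrix.SpecialLinearGroup (Fin 2) F) →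
        IsEpsKUniform
          (((Fintype.card (Matrix.SpecialLinearGroup (Fin 2) F) : ℝ) ^ k)⁻¹) k p →
        (m ≤ t → IsEpsKUniform
          (((Fintype.card (Matrix.SpecialLinearGroup (Fin 2) F) : ℝ) ^ m)⁻¹) m
          (groupConvPow p n)) ∧
        (t ≤ m → IsEpsUniform
          (((Fintype.card (Matrix.SpecialLinearGroup (Fin 2) F) : ℝ) ^ m)⁻¹)
          (groupConvPow p n)) := by
  obtain ⟨n, hn, H⟩ := exists_groupConvPow_uniform
  -- With c = 1/144, rounding up gives m < 145k/144 + 1, the integer inequality used throughout.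
  refine ⟨1 / 144, n, by norm_num, hn, fun F _ _ _ hF k t m hk hkt hm p hp hpk => ?_⟩
  have hm1 : 144 * m < 145 * k + 144 := by
    have h1 := Nat.ceil_lt_add_one (show (0 : ℝ) ≤ (1 + 1 / 144) * (k : ℝ) by positivity)
    rw [← hm] at h1
    have h2 : (144 : ℝ) * m < 145 * k + 144 := by linarith
    exact_mod_cast h2
  have hkm : k ≤ m := by
    have h1 := Nat.le_ceil ((1 + 1 / 144) * (k : ℝ))
    rw [← hm] at h1
    have h2 : (k : ℝ) ≤ m := by
      have : (0 : ℝ) ≤ k := by positivity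
      linarith
    exact_mod_cast h2
  have hpk' : ∀ I : Finset (Fin t), I.card = k → IsEpsUniform
      (((Fintype.card (Matrix.SpecialLinearGroup (Fin 2) F) : ℝ) ^ k)⁻¹) (marginal p I) := hpk
  constructor
  · intro _ I hI
    change IsEpsUniform _ (marginal (groupConvPow p n) I)
    rw [marginal_groupConvPow]
    refine H F hF I k m hk (by rwa [Fintype.card_coe, hI]) (by rw [Fintype.card_coe, hI]) hm1 _
      (marginal_nonneg p hp.1 I) (by rw [sum_marginal, hp.2]) fun J hJ => ?_
    exact isEpsUniform_marginal_marginal p I J _ (hpk' _ (by rw [Finset.card_map, hJ]))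
  · intro htm
    exact H F hF (Fin t) k m hk (by rwa [Fintype.card_fin]) (by rwa [Fintype.card_fin]) hm1 p
      hp.1 hp.2 hpk'
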